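/- Let $N,K\in\mathbb N$ and let $M=(M_{x,y}^{a,b})_{x,y=1,\dots,N;\,a,b=1,\dots,K}$ be a family of complex coefficients (a Bell functional), acting on families $P=(P(a,b|x,y))$ of real numbers by $\langle M,P\rangle=\sum_{x,y,a,b}M_{x,y}^{a,b}P(a,b|x,y)$. Let $\mathcal L^{in}$ be the set of incomplete classical distributions $P(a,b|x,y)=\int_\Omega P_\omega(a|x)\,Q_\omega(b|y)\,d\mathbb P(\omega)$, where $(\Omega,\mathbb P)$ is a probability space, $P_\omega(a|x),Q_\omega(b|y)\ge 0$, and $\sum_a P_\omega(a|x)\le 1$, $\sum_b Q_\omega(b|y)\le 1$ for all $x,y,\omega$. Let $\mathcal Q^{in}$ be the set of incomplete quantum distributions $P(a,b|x,y)=\mathrm{tr}\big((E_x^a\otimes F_y^b)\rho\big)$, where $H_1,H_2$ are complex Hilbert spaces, $\rho$ is a density operator on $H_1\otimes H_2$, and $E_x^a\in B(H_1)$, $F_y^b\in B(H_2)$ are positive operators with $\sum_aE_x^a\le 1$ and $\sum_bF_y^b\le 1$ for all $x,y$ (incomplete POVMs). Put $$B_C(M)=\sup_{P\in\mathcal L^{in}}|\langle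 M,P\rangle|,\qquad B_Q(M)=\sup_{P\in\mathcal Q^{in}}|\langle M,P\rangle|,\qquad LV(M)=\frac{B_Q(M)}{B_C(M)}\ \text{ if } B_C(M)\ne 0.$$ Let $X=\ell_1^N(\ell_\infty^K)$ over $\mathbb C$, with its natural operator space structure (the operator space $\ell_1$-sum of $N$ copies of $\ell_\infty^K$), and identify $M$ with $\sum_{x,y,a,b}M_{x,y}^{a,b}(e_x\otimes e_a)\otimes(e_y\otimes e_b)\in X\otimes X$. Let $\|M\|_{X\otimes_{\min}X}=\sup\|(u\otimes v)(M)\|_{B(H_1\otimes H_2)}$, the supremum being over all Hilbert spaces $H_1,H_2$ and all complete contractions $u:X\to B(H_1)$, $v:X\to B(H_2)$, and let $\|M\|_{X\otimes_{\epsilon}X}=\sup\{|(\varphi\otimes\psi)(M)|:\varphi,\psi\in X^*,\ \|\varphi\|,\|\psi\|\le 1\}$. Then: 1. For all $N,K$ and $M$, $$B_Q(M)\le \|M\|_{X\otimes_{\min}X}\le 16\,B_Q(M).$$ 2. There are universal constants $c,C>0$ such that for all $N,K$ and all $M$ with $B_C(M)\neq 0$, $$c\,\frac{\|M\|_{X\otimes_{\min}X}}{\|M\|_{X\otimes_{\epsilon}X}}\le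 LV(M)\le C\,\frac{\|M\|_{X\otimes_{\min}X}}{\|M\|_{X\otimes_{\epsilon}X}}.$$ -/

import Mathlib

open scoped TensorProduct InnerProductSpace

noncomputable section

namespace BellMin

/-! ### Bell functionals, classical and quantum bounds -/

/-- The coefficients `M x y a b` of a linear functional on families `P x y a b`
(= `P(a,b|x,y)`), with inputs `x, y` in `Fin N` and outputs `a, b` in `Fin K`. -/
abbrev BellFunctional (N K : ℕ) := Fin N → Fin N → Fin K → Fin K → ℂ

/-- A family of numbers `P x y a b`, standing for `P(a,b|x,y)`. -/
abbrev Behaviour (N K : ℕ) := Fin N → Fin N → Fin K → Fin K → ℝ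

/-- The pairing `⟨M, P⟩ = ∑ M_{x,y}^{a,b} P(a,b|x,y)`. -/
def pairing {N K : ℕ} (M : BellFunctional N K) (P : Behaviour N K) : ℂ :=
  ∑ x, ∑ y, ∑ a, ∑ b, M x y a b * (P x y a b : ℂ)

/-- Incomplete classical distributions: `P(a,b|x,y) = ∫ p_ω(a|x) q_ω(b|y) dμ(ω)` for a
probability space and subnormalised nonnegative families `p_ω`, `q_ω`. -/
def IsIncompleteClassical {N K : ℕ} (P : Behaviour N K) : Prop :=
  ∃ (Ω : Type) (_ : MeasurableSpace Ω) (μ : MeasureTheory.Measure Ω)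
    (p q : Ω → Fin N → Fin K → ℝ),
    MeasureTheory.IsProbabilityMeasure μ ∧
    (∀ x a, Measurable fun ω => p ω x a) ∧ (∀ y b, Measurable fun ω => q ω y b) ∧
    (∀ ω x a, 0 ≤ p ω x a) ∧ (∀ ω x, ∑ a, p ω x a ≤ 1) ∧
    (∀ ω y b, 0 ≤ q ω y b) ∧ (∀ ω y, ∑ b, q ω y b ≤ 1) ∧
    ∀ x y a b, P x y a b = ∫ ω, p ω x a * q ω y b ∂μ

section Hilbert

variable (H₁ H₂ : Type*) [NormedAddCommGroup H₁] [InnerProductSpace ℂ H₁]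
  [NormedAddCommGroup H₂] [InnerProductSpace ℂ H₂]

/-- The Hilbert space tensor product: the completion of the algebraic tensor product with
respect to `⟪a ⊗ b, c ⊗ d⟫ = ⟪a, c⟫ ⟪b, d⟫`. -/
abbrev HilbertTensor := UniformSpace.Completion (H₁ ⊗[ℂ] H₂)

variable {H₁ H₂}

/-- The bounded operator `S ⊗ T` on the Hilbert space tensor product. -/
def tensorOp (S : H₁ →L[ℂ] H₁) (T : H₂ →L[ℂ] H₂) :
    HilbertTensor H₁ H₂ →L[ℂ] HilbertTensor H₁ H₂ :=
  (TensorProduct.mapL S T).completion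

variable (H₁ H₂)

theorem completion_add' {E : Type*} [NormedAddCommGroup E] [NormedSpace ℂ E] (f g : E →L[ℂ] E) :
    (f + g).completion = f.completion + g.completion := by
  ext x
  induction x using UniformSpace.Completion.induction_on with
  | hp => exact isClosed_eq (f + g).completion.continuous (f.completion + g.completion).continuous
  | ih a => simp [UniformSpace.Completion.coe_add]

theorem completion_smul' {E : Type*} [NormedAddCommGroup E] [NormedSpace ℂ E] (c : ℂ)
    (f : E →L[ℂ] E) : (c • f).completion = c • f.completion := by
  ext x
  induction x using UniformSpace.Completion.induction_on with
  | hp => exact isClosed_eq (c • f).completion.continuous (c • f.completion).continuous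
  | ih a =>
    rw [smul_apply, ContinuousLinearMap.completion_apply_coe,
      ContinuousLinearMap.completion_apply_coe, smul_apply,
      UniformSpace.Completion.coe_smul]

/-- The canonical linear map `B(H₁) ⊗ B(H₂) → B(H₁ ⊗ H₂)` sending `S ⊗ T` to `S ⊗ T`. -/
def tensorOpLin : (H₁ →L[ℂ] H₁) ⊗[ℂ] (H₂ →L[ℂ] H₂) →ₗ[ℂ]
    (HilbertTensor H₁ H₂ →L[ℂ] HilbertTensor H₁ H₂) :=
  TensorProduct.lift (LinearMap.mk₂ ℂ tensorOp
    (fun S S' T => by simp only [tensorOp, TensorProduct.mapL_add_left, completion_add'])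
    (fun c S T => by simp only [tensorOp, TensorProduct.mapL_smul_left, completion_smul'])
    (fun S T T' => by simp only [tensorOp, TensorProduct.mapL_add_right, completion_add'])
    (fun c S T => by simp only [tensorOp, TensorProduct.mapL_smul_right, completion_smul']))

end Hilbert

/-- `T` is of trace class with trace `t`: for every orthonormal (Hilbert) basis the diagonal sum
`∑ ⟪b i, T (b i)⟫` converges (unconditionally) to `t`. -/
def HasTrace {H : Type} [NormedAddCommGroup H] [InnerProductSpace ℂ H]
    (T : H →L[ℂ] H) (t : ℂ) : Prop :=
  ∀ (ι : Type) (b : HilbertBasis ι ℂ H), HasSum (fun i => ⟪b i, T (b i)⟫_ℂ) t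

/-- A density operator: positive with trace one. -/
def IsDensity {H : Type} [NormedAddCommGroup H] [InnerProductSpace ℂ H] [CompleteSpace H]
    (ρ : H →L[ℂ] H) : Prop :=
  0 ≤ ρ ∧ HasTrace ρ 1

/-- A family of incomplete POVMs: `E x a ≥ 0` and `∑ a, E x a ≤ 1` for every `x`. -/
def IsIncompletePOVM {N K : ℕ} {H : Type} [NormedAddCommGroup H] [InnerProductSpace ℂ H]
    [CompleteSpace H] (E : Fin N → Fin K → (H →L[ℂ] H)) : Prop :=
  (∀ x a, 0 ≤ E x a) ∧ ∀ x, ∑ a, E x a ≤ 1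

/-- Incomplete quantum distributions: `P(a,b|x,y) = tr ((E_x^a ⊗ F_y^b) ρ)`. -/
def IsIncompleteQuantum {N K : ℕ} (P : Behaviour N K) : Prop :=
  ∃ (H₁ : Type) (_ : NormedAddCommGroup H₁) (_ : InnerProductSpace ℂ H₁) (_ : CompleteSpace H₁)
    (H₂ : Type) (_ : NormedAddCommGroup H₂) (_ : InnerProductSpace ℂ H₂) (_ : CompleteSpace H₂)
    (E : Fin N → Fin K → (H₁ →L[ℂ] H₁)) (F : Fin N → Fin K → (H₂ →L[ℂ] H₂))
    (ρ : HilbertTensor H₁ H₂ →L[ℂ] HilbertTensor H₁ H₂),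
    IsIncompletePOVM E ∧ IsIncompletePOVM F ∧ IsDensity ρ ∧
    ∀ x y a b, HasTrace (tensorOp (E x a) (F y b) ∘L ρ) (P x y a b : ℂ)

/-- The classical bound `B_C(M)` (the set is bounded by `∑ ‖M x y a b‖`). -/
def classicalBound {N K : ℕ} (M : BellFunctional N K) : ℝ :=
  sSup {r : ℝ | ∃ P : Behaviour N K, IsIncompleteClassical P ∧ r = ‖pairing M P‖}

/-- The quantum bound `B_Q(M)` (the set is bounded by `∑ ‖M x y a b‖`). -/
def quantumBound {N K : ℕ} (M : BellFunctional N K) : ℝ :=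
  sSup {r : ℝ | ∃ P : Behaviour N K, IsIncompleteQuantum P ∧ r = ‖pairing M P‖}

/-- The largest quantum violation `LV(M) = B_Q(M) / B_C(M)`. -/
def largestViolation {N K : ℕ} (M : BellFunctional N K) : ℝ :=
  quantumBound M / classicalBound M

/-! ### Operator space structures and the minimal tensor norm -/

/-- A sequence of norms on the spaces `M_n(E)`. -/
abbrev MatrixNorms (E : Type*) := (n : ℕ) → Matrix (Fin n) (Fin n) E → ℝ

/-- A matrix of operators on `H` as an operator on `ℓ₂ⁿ(H)`. -/
def blockOp {H : Type*} [NormedAddCommGroup H] [InnerProductSpace ℂ H] {n : ℕ}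
    (T : Matrix (Fin n) (Fin n) (H →L[ℂ] H)) :
    PiLp 2 (fun _ : Fin n => H) →L[ℂ] PiLp 2 (fun _ : Fin n => H) :=
  (PiLp.continuousLinearEquiv 2 ℂ (fun _ : Fin n => H)).symm.toContinuousLinearMap ∘L
    ContinuousLinearMap.pi fun i => ∑ j, T i j ∘L PiLp.proj 2 (fun _ : Fin n => H) j

/-- The operator space structure of `B(H)`: `M_n(B(H)) = B(ℓ₂ⁿ(H))`. -/
def opNorms (H : Type*) [NormedAddCommGroup H] [InnerProductSpace ℂ H] :
    MatrixNorms (H →L[ℂ] H) :=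
  fun _ T => ‖blockOp T‖

/-- The operator space structure of `ℓ_∞^K`: the norm of `∑ A_k ⊗ e_k` in `M_n(ℓ_∞^K)` is
`max_k ‖A_k‖`. -/
def supNorms (K : ℕ) : MatrixNorms (Fin K → ℂ) :=
  fun n A => ⨆ k : Fin K, ‖Matrix.toEuclideanCLM (n := Fin n) (𝕜 := ℂ) (A.map fun f => f k)‖

/-- A linear map with `‖u‖_cb ≤ 1`. -/
def IsCompleteContraction {E F : Type*} [AddCommGroup E] [Module ℂ E] [AddCommGroup F]
    [Module ℂ F] (ν : MatrixNorms E) (ν' : MatrixNorms F) (u : E →ₗ[ℂ] F) : Prop :=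
  ∀ (n : ℕ) (A : Matrix (Fin n) (Fin n) E), ν' n (A.map u) ≤ ν n A

/-- The operator space structure of the `ℓ₁`-sum `ℓ₁^N(E)`: the norm of an element of
`M_n(ℓ₁^N(E))` is the supremum of the norms in `M_n(B(H))` of its images under the maps
`(e_i)_i ↦ ∑ u_i(e_i)`, over all families of complete contractions `u_i : E → B(H)`. -/
def oneSumNorms (N : ℕ) {E : Type*} [AddCommGroup E] [Module ℂ E] (ν : MatrixNorms E) :
    MatrixNorms (PiLp 1 (fun _ : Fin N => E)) :=
  fun n A => sSup {r : ℝ | ∃ (H : Type) (_ : NormedAddCommGroup H) (_ : InnerProductSpace ℂ H)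
    (_ : CompleteSpace H) (u : Fin N → (E →ₗ[ℂ] (H →L[ℂ] H))),
    (∀ i, IsCompleteContraction ν (opNorms H) (u i)) ∧
    r = opNorms H n (A.map fun e => ∑ i, u i (e i))}

/-- The minimal tensor norm: the supremum of the norms of `(u ⊗ v)(z)` in
`B(H₁) ⊗_min B(H₂) ⊆ B(H₁ ⊗ H₂)` over all complete contractions `u : E → B(H₁)` and
`v : F → B(H₂)`. -/
def minNorm {E F : Type*} [AddCommGroup E] [Module ℂ E] [AddCommGroup F] [Module ℂ F]
    (ν : MatrixNorms E) (ν' : MatrixNorms F) (z : E ⊗[ℂ] F) : ℝ :=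
  sSup {r : ℝ | ∃ (H₁ : Type) (_ : NormedAddCommGroup H₁) (_ : InnerProductSpace ℂ H₁)
    (_ : CompleteSpace H₁) (H₂ : Type) (_ : NormedAddCommGroup H₂)
    (_ : InnerProductSpace ℂ H₂) (_ : CompleteSpace H₂)
    (u : E →ₗ[ℂ] (H₁ →L[ℂ] H₁)) (v : F →ₗ[ℂ] (H₂ →L[ℂ] H₂)),
    IsCompleteContraction ν (opNorms H₁) u ∧ IsCompleteContraction ν' (opNorms H₂) v ∧
    r = ‖tensorOpLin H₁ H₂ (TensorProduct.map u v z)‖}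

/-- The injective tensor norm: the supremum of `|(φ ⊗ ψ)(z)|` over the dual unit balls. -/
def epsNorm {E F : Type*} [NormedAddCommGroup E] [NormedSpace ℂ E] [NormedAddCommGroup F]
    [NormedSpace ℂ F] (z : E ⊗[ℂ] F) : ℝ :=
  sSup {r : ℝ | ∃ (φ : E →L[ℂ] ℂ) (ψ : F →L[ℂ] ℂ), ‖φ‖ ≤ 1 ∧ ‖ψ‖ ≤ 1 ∧
    r = ‖TensorProduct.lid ℂ ℂ (TensorProduct.map φ.toLinearMap ψ.toLinearMap z)‖}

/-! ### The space `ℓ₁^N(ℓ_∞^K)` and the tensor of a Bell functional -/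

/-- The Banach space `ℓ₁^N(ℓ_∞^K)`. -/
abbrev L1Linf (N K : ℕ) := PiLp 1 (fun _ : Fin N => (Fin K → ℂ))

/-- The operator space structure of `ℓ₁^N(ℓ_∞^K)`. -/
def l1LinfNorms (N K : ℕ) : MatrixNorms (L1Linf N K) :=
  oneSumNorms N (supNorms K)

/-- The vector `e_x ⊗ e_a` of `ℓ₁^N(ℓ_∞^K)`. -/
def basisVec {N K : ℕ} (x : Fin N) (a : Fin K) : L1Linf N K :=
  WithLp.toLp 1 (Pi.single x (Pi.single a 1))

/-- The tensor `∑ M_{x,y}^{a,b} (e_x ⊗ e_a) ⊗ (e_y ⊗ e_b)`. -/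
def bellTensor {N K : ℕ} (M : BellFunctional N K) : L1Linf N K ⊗[ℂ] L1Linf N K :=
  ∑ x, ∑ y, ∑ a, ∑ b, M x y a b • (basisVec x a ⊗ₜ[ℂ] basisVec y b)

/-- The norm of `M` in `ℓ₁^N(ℓ_∞^K) ⊗_min ℓ₁^N(ℓ_∞^K)`. -/
def bellMinNorm {N K : ℕ} (M : BellFunctional N K) : ℝ :=
  minNorm (l1LinfNorms N K) (l1LinfNorms N K) (bellTensor M)

/-- The norm of `M` in `ℓ₁^N(ℓ_∞^K) ⊗_ε ℓ₁^N(ℓ_∞^K)`. -/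
def bellEpsNorm {N K : ℕ} (M : BellFunctional N K) : ℝ :=
  epsNorm (bellTensor M)

end BellMin

end

/-!
An incomplete POVM `E` defines a complete contraction `e_a ↦ E_a`, because the matrix of its
values factors through the square roots of the `E_a`. Since `|tr (T ρ)| ≤ ‖T‖` for a density `ρ`,
every quantum value is at most the minimal norm.

Conversely, testing `‖(u ⊗ v)(M)‖` on vectors of the algebraic tensor product compresses `u` and
`v` to families of matrices, and `U_a` denotes such a family for a fixed input. In trace-dual form,
complete contractivity says that the matrices `[[1/K, U_a], [U_aᴴ, 1/K]]` define a positive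
functional on the families of block matrices whose diagonal blocks do not depend on `a`. Krein's
theorem extends this functional to a positive one on all families, which gives positive block
matrices `R_a` with corner `U_a` such that `∑ R_a` has identity diagonal blocks. Conjugating
`R_a / 2` with `diag(1, i^k)` gives four incomplete POVMs, and averaging over `k` writes
`[[0, U_a], [0, 0]]` as a combination of them with coefficients of modulus `1/2`.
The unit vectors `z` and `w` which almost attain the norm are placed on complementary corners of
the doubled spaces, as a vector of squared norm `2`. This yields `‖M‖_min ≤ 4 · 2 · B_Q(M)`.

Functionals in the unit ball of `X*` are families with `∑_a |φ_x^a| ≤ 1`. Product strategies are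
such functionals, and each splits into four nonnegative incomplete distributions, so
`B_C(M) ≤ ‖M‖_ε ≤ 16 B_C(M)`.
-/

noncomputable section

namespace BellMin

section KreinExtension

open scoped ComplexOrder

variable {A : Type*} [CStarAlgebra A] [PartialOrder A] [StarOrderedRing A]

/-- The cone of accretive elements, those with positive real part. The order on a C⋆-algebra only
sees self-adjoint elements; this cone makes the Riesz extension theorem applicable to all of `A`. -/
def accretiveCone (A : Type*) [CStarAlgebra A] [PartialOrder A] [StarOrderedRing A] :
    PointedCone ℝ A :=
  (PointedCone.positive ℝ A).comap (LinearMap.id + (starLinearEquiv ℝ).toLinearMap)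

theorem mem_accretiveCone {x : A} : x ∈ accretiveCone A ↔ 0 ≤ x + star x := Iff.rfl

theorem mem_accretiveCone_of_nonneg {x : A} (hx : 0 ≤ x) : x ∈ accretiveCone A :=
  add_nonneg hx (star_nonneg_iff.2 hx)

theorem I_smul_mem_accretiveCone {x : A} (hx : IsSelfAdjoint x) :
    Complex.I • x ∈ accretiveCone A := by
  simp [mem_accretiveCone, star_smul, hx.star_eq]

theorem exists_algebraMap_add_mem_accretiveCone (x : A) :
    ∃ c : ℝ, algebraMap ℝ A c + x ∈ accretiveCone A := by
  have hx : IsSelfAdjoint (x + star x) := IsSelfAdjoint.add_star_self x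
  refine ⟨‖x + star x‖, mem_accretiveCone.2 ?_⟩
  have hle : 0 ≤ algebraMap ℝ A ‖x + star x‖ + (x + star x) := by
    simpa [add_comm] using neg_le_iff_add_nonneg.1 hx.neg_algebraMap_norm_le_self
  have hpos : 0 ≤ algebraMap ℝ A ‖x + star x‖ := algebraMap_nonneg A (norm_nonneg _)
  calc 0 ≤ algebraMap ℝ A ‖x + star x‖ + (x + star x) + algebraMap ℝ A ‖x + star x‖ :=
        add_nonneg hle hpos
    _ = _ := by
        rw [star_add, (IsSelfAdjoint.of_nonneg hpos).star_eq]
        abel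

/-- A functional which is nonnegative on accretive elements is real on self-adjoint ones, because
`i x` and `-i x` are then both accretive. -/
theorem extendRCLike_nonneg {g : Module.Dual ℝ A} (hg : ∀ x ∈ accretiveCone A, 0 ≤ g x) {x : A}
    (hx : 0 ≤ x) : 0 ≤ (g.extendRCLike : Module.Dual ℂ A) x := by
  have hsa := IsSelfAdjoint.of_nonneg hx
  have hI : g (Complex.I • x) = 0 := by
    refine le_antisymm ?_ (hg _ (I_smul_mem_accretiveCone hsa))
    simpa using hg _ (I_smul_mem_accretiveCone hsa.neg)
  simpa [Module.Dual.extendRCLike_apply, hI] using hg x (mem_accretiveCone_of_nonneg hx)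

variable {L : Submodule ℂ A} {f : L →ₗ[ℂ] ℂ}

theorem im_apply_eq_zero_of_isSelfAdjoint (h1 : 1 ∈ L) (hf : ∀ x : L, 0 ≤ (x : A) → 0 ≤ f x)
    {x : L} (hx : IsSelfAdjoint (x : A)) : (f x).im = 0 := by
  have him {y : L} (hy : 0 ≤ (y : A)) : (f y).im = 0 := (Complex.nonneg_iff.1 (hf y hy)).2.symm
  set c : L := (‖(x : A)‖ : ℂ) • ⟨1, h1⟩
  have hc : (c : A) = algebraMap ℝ A ‖(x : A)‖ := by
    simp [c, Algebra.algebraMap_eq_smul_one, Complex.coe_smul]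
  have hcx : 0 ≤ ((c + x : L) : A) := by
    rw [Submodule.coe_add, hc]
    simpa [add_comm] using neg_le_iff_add_nonneg.1 hx.neg_algebraMap_norm_le_self
  have hadd := him hcx
  rwa [map_add, Complex.add_im, him (hc ▸ algebraMap_nonneg A (norm_nonneg _)), zero_add] at hadd

theorem re_apply_nonneg_of_mem_accretiveCone (hL : ∀ x ∈ L, star x ∈ L) (h1 : 1 ∈ L)
    (hf : ∀ x : L, 0 ≤ (x : A) → 0 ≤ f x) {x : L} (hx : (x : A) ∈ accretiveCone A) :
    0 ≤ (f x).re := by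
  set y : L := ⟨star x, hL x x.2⟩
  have hsub : (f (Complex.I • (x - y))).im = 0 :=
    im_apply_eq_zero_of_isSelfAdjoint h1 hf (by simp [IsSelfAdjoint, y, ← smul_neg])
  have hadd : 0 ≤ (f (x + y)).re := (Complex.nonneg_iff.1 (hf (x + y) hx)).1
  simp only [map_smul, map_sub, smul_eq_mul, Complex.I_mul_im, Complex.sub_re] at hsub
  rw [map_add, Complex.add_re] at hadd
  linarith

/-- Krein's extension theorem. -/
theorem exists_nonneg_extension (hL : ∀ x ∈ L, star x ∈ L) (h1 : 1 ∈ L)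
    (hf : ∀ x : L, 0 ≤ (x : A) → 0 ≤ f x) :
    ∃ g : A →ₗ[ℂ] ℂ, (∀ x : L, g x = f x) ∧ ∀ x, 0 ≤ x → 0 ≤ g x := by
  obtain ⟨g, hgf, hg⟩ := riesz_extension (accretiveCone A)
    ⟨L.restrictScalars ℝ, Complex.reLm ∘ₗ f.restrictScalars ℝ⟩
    (fun x hx => re_apply_nonneg_of_mem_accretiveCone hL h1 hf hx)
    (fun x => by
      obtain ⟨c, hc⟩ := exists_algebraMap_add_mem_accretiveCone x
      have hcL : algebraMap ℝ A c ∈ L := by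
        rw [Algebra.algebraMap_eq_smul_one]
        exact (L.restrictScalars ℝ).smul_mem c h1
      exact ⟨⟨_, hcL⟩, hc⟩)
  refine ⟨Module.Dual.extendRCLike g, fun x => ?_, fun x hx => extendRCLike_nonneg hg hx⟩
  have hre (y : L) : g y = (f y).re := hgf y
  have hI : g (Complex.I • (x : A)) = (f (Complex.I • x)).re := hre (Complex.I • x)
  rw [Module.Dual.extendRCLike_apply]
  apply Complex.ext <;> simp [hre, hI]

end KreinExtension

section SchurPairing

open Matrix
open scoped ComplexOrder MatrixOrder Matrix.Norms.L2Operator Topology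

variable {κ ι : Type*} [Fintype κ] [Fintype ι]

/-- The bilinear pairing `∑ R_a(p,q) B_a(p,q)` of two families of matrices. No conjugation or
transposition is involved, so `R` positive semidefinite corresponds to a positive functional. -/
def schurPairing (R : κ → Matrix ι ι ℂ) : (κ → Matrix ι ι ℂ) →ₗ[ℂ] ℂ where
  toFun B := ∑ a, ∑ p, ∑ q, R a p q * B a p q
  map_add' B C := by simp [mul_add, Finset.sum_add_distrib]
  map_smul' c B := by simp [Finset.mul_sum, mul_left_comm]

theorem schurPairing_apply (R B : κ → Matrix ι ι ℂ) :
    schurPairing R B = ∑ a, ∑ p, ∑ q, R a p q * B a p q := rfl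

theorem schurPairing_single [DecidableEq κ] (R : κ → Matrix ι ι ℂ) (a : κ) (B : Matrix ι ι ℂ) :
    schurPairing R (Pi.single a B) = ∑ p, ∑ q, R a p q * B p q := by
  rw [schurPairing_apply, Fintype.sum_eq_single a fun a' ha => by simp [ha]]
  simp

theorem schurPairing_single_vecMulVec [DecidableEq κ] (R : κ → Matrix ι ι ℂ) (a : κ)
    (v : ι → ℂ) :
    schurPairing R (Pi.single a (vecMulVec (star v) v)) = star v ⬝ᵥ R a *ᵥ v := by
  simp only [schurPairing_single, vecMulVec_apply, dotProduct, mulVec, Finset.mul_sum]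
  exact Finset.sum_congr rfl fun p _ => Finset.sum_congr rfl fun q _ => by ring

theorem schurPairing_single_single [DecidableEq κ] [DecidableEq ι] (R : κ → Matrix ι ι ℂ)
    (a : κ) (p q : ι) (z : ℂ) :
    schurPairing R (Pi.single a (Matrix.single p q z)) = R a p q * z := by
  rw [schurPairing_single, Fintype.sum_eq_single p fun p' hp => by simp [hp.symm],
    Fintype.sum_eq_single q fun q' hq => by simp [hq.symm], single_apply_same]

theorem schurPairing_apply_single [DecidableEq κ] [DecidableEq ι]
    (g : (κ → Matrix ι ι ℂ) →ₗ[ℂ] ℂ) :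
    schurPairing (fun a => of fun p q => g (Pi.single a (Matrix.single p q 1))) = g := by
  refine LinearMap.pi_ext' fun a => Matrix.ext_linearMap _ fun p q => ?_
  ext
  simp [schurPairing_single_single]

theorem posSemidef_of_schurPairing_nonneg {R : κ → Matrix ι ι ℂ}
    (hR : ∀ B, 0 ≤ B → 0 ≤ schurPairing R B) (a : κ) : (R a).PosSemidef := by
  classical
  rw [← isPositive_toEuclideanLin_iff, LinearMap.isPositive_iff_complex]
  intro v
  have hinner : ⟪toEuclideanLin (R a) v, v⟫_ℂ = star (star v.ofLp ⬝ᵥ R a *ᵥ v.ofLp) := by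
    rw [← inner_conj_symm, EuclideanSpace.inner_eq_star_dotProduct, dotProduct_comm]
    rfl
  have hv : 0 ≤ star (star v.ofLp ⬝ᵥ R a *ᵥ v.ofLp) := by
    rw [star_nonneg_iff, ← schurPairing_single_vecMulVec]
    exact hR _ (Pi.single_nonneg.2 (posSemidef_vecMulVec_star_self _).nonneg)
  rw [hinner]
  exact ⟨Complex.eq_re_of_ofReal_le hv |>.symm, (Complex.nonneg_iff.1 hv).1⟩

theorem exists_posSemidef_schurPairing_eq [DecidableEq ι] {L : Submodule ℂ (κ → Matrix ι ι ℂ)}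
    (hL : ∀ B ∈ L, star B ∈ L) (h1 : 1 ∈ L) {f : L →ₗ[ℂ] ℂ}
    (hf : ∀ B : L, 0 ≤ (B : κ → Matrix ι ι ℂ) → 0 ≤ f B) :
    ∃ R : κ → Matrix ι ι ℂ, (∀ a, (R a).PosSemidef) ∧ ∀ B : L, schurPairing R B = f B := by
  classical
  obtain ⟨g, hgf, hg⟩ := exists_nonneg_extension hL h1 hf
  refine ⟨fun a => of fun p q => g (Pi.single a (Matrix.single p q 1)),
    posSemidef_of_schurPairing_nonneg ?_, ?_⟩ <;>
  rwa [schurPairing_apply_single]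

end SchurPairing

section Dilation

open Matrix
open scoped ComplexOrder MatrixOrder Matrix.Norms.L2Operator Topology

variable {κ ι : Type*}

/-- The operator system of families of block matrices whose diagonal blocks do not depend on the
index. -/
def constDiagBlocks (κ ι : Type*) : Submodule ℂ (κ → Matrix (ι ⊕ ι) (ι ⊕ ι) ℂ) where
  carrier := {B | ∀ a a' i j, B a (.inl i) (.inl j) = B a' (.inl i) (.inl j) ∧
    B a (.inr i) (.inr j) = B a' (.inr i) (.inr j)}
  add_mem' hB hC a a' i j := by simp [hB a a' i j, hC a a' i j]
  zero_mem' a a' i j := by simp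
  smul_mem' c B hB a a' i j := by simp [hB a a' i j]

theorem star_mem_constDiagBlocks {B : κ → Matrix (ι ⊕ ι) (ι ⊕ ι) ℂ}
    (hB : B ∈ constDiagBlocks κ ι) : star B ∈ constDiagBlocks κ ι := fun a a' i j => by
  simp [star_apply, hB a a' j i]

theorem const_mem_constDiagBlocks (B : Matrix (ι ⊕ ι) (ι ⊕ ι) ℂ) :
    (fun _ => B) ∈ constDiagBlocks κ ι := fun _ _ _ _ => ⟨rfl, rfl⟩

variable [Fintype ι] [DecidableEq ι]

theorem l2_opNorm_le_one_of_posSemidef_one_sub {A : Matrix ι ι ℂ}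
    (hA : (1 - Aᴴ * A).PosSemidef) : ‖A‖ ≤ 1 := by
  have h := (CStarAlgebra.norm_le_one_iff_of_nonneg (star A * A) (star_mul_self_nonneg A)).2
    (Matrix.le_iff.2 hA)
  rw [CStarRing.norm_star_mul_self] at h
  nlinarith [norm_nonneg A]

/-- A positive semidefinite block matrix with invertible diagonal blocks `Sᴴ S` and `Tᴴ T` is
`diag(S, T)ᴴ [[1, A], [Aᴴ, 1]] diag(S, T)`, and the middle factor is positive iff `‖A‖ ≤ 1`. -/
theorem exists_contraction_of_posSemidef_fromBlocks {S T Z : Matrix ι ι ℂ}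
    (hS : IsUnit S) (hT : IsUnit T) (h : (fromBlocks (Sᴴ * S) Z Zᴴ (Tᴴ * T)).PosSemidef) :
    ∃ A : Matrix ι ι ℂ, ‖A‖ ≤ 1 ∧ Z = Sᴴ * A * T := by
  have hSd : IsUnit S.det := (isUnit_iff_isUnit_det S).1 hS
  have hTd : IsUnit T.det := (isUnit_iff_isUnit_det T).1 hT
  have hSd' : IsUnit Sᴴ.det := by simpa using hSd.star
  have hTd' : IsUnit Tᴴ.det := by simpa using hTd.star
  set D : Matrix (ι ⊕ ι) (ι ⊕ ι) ℂ := fromBlocks S⁻¹ 0 0 T⁻¹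
  set A : Matrix ι ι ℂ := Sᴴ⁻¹ * Z * T⁻¹
  have hfactor : Dᴴ * fromBlocks (Sᴴ * S) Z Zᴴ (Tᴴ * T) * D = fromBlocks 1 A Aᴴ 1 := by
    simp [A, D, fromBlocks_conjTranspose, fromBlocks_multiply, conjTranspose_nonsing_inv,
      Matrix.mul_assoc, mul_nonsing_inv S hSd, mul_nonsing_inv T hTd, nonsing_inv_mul _ hSd',
      nonsing_inv_mul _ hTd']
  have hA := hfactor ▸ h.conjTranspose_mul_mul_same D
  let : Invertible (1 : Matrix ι ι ℂ) := invertibleOne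
  rw [PosDef.fromBlocks₁₁ _ _ PosDef.one] at hA
  refine ⟨A, l2_opNorm_le_one_of_posSemidef_one_sub (by simpa using hA), ?_⟩
  simp [A, Matrix.mul_assoc, nonsing_inv_mul T hTd, mul_nonsing_inv_cancel_left _ _ hSd']

/-- The trace-dual form of complete contractivity of the map `e_a ↦ U_a` on `ℓ_∞(κ)`. -/
def IsTraceContractive [Fintype κ] (U : κ → Matrix ι ι ℂ) : Prop :=
  ∀ A : κ → Matrix ι ι ℂ, (∀ a, ‖A a‖ ≤ 1) → ∀ S T : Matrix ι ι ℂ,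
    ‖schurPairing U fun a => Sᴴ * A a * T‖ ≤ ((Sᴴ * S).trace.re + (Tᴴ * T).trace.re) / 2

variable [Fintype κ]

/-- The matrices `[[1/|κ|, U_a], [U_aᴴ, 1/|κ|]]`. On families with constant diagonal blocks `X`, `Y`
their Schur pairing has diagonal part `tr X + tr Y`. -/
def dilationKernel (U : κ → Matrix ι ι ℂ) (a : κ) : Matrix (ι ⊕ ι) (ι ⊕ ι) ℂ :=
  fromBlocks ((Fintype.card κ : ℂ)⁻¹ • 1) (U a) (U a)ᴴ ((Fintype.card κ : ℂ)⁻¹ • 1)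

variable [Nonempty κ]

theorem schurPairing_dilationKernel_fromBlocks (U : κ → Matrix ι ι ℂ) (X Y : Matrix ι ι ℂ)
    (Z : κ → Matrix ι ι ℂ) :
    schurPairing (dilationKernel U) (fun a => fromBlocks X (Z a) (Z a)ᴴ Y) =
      X.trace + Y.trace + (schurPairing U Z + star (schurPairing U Z)) := by
  have hK : (Fintype.card κ : ℂ) ≠ 0 := Nat.cast_ne_zero.2 Fintype.card_ne_zero
  have hdiag (W : Matrix ι ι ℂ) : ∑ _ : κ, ∑ i, ∑ j,
      ((Fintype.card κ : ℂ)⁻¹ • (1 : Matrix ι ι ℂ)) i j * W i j = W.trace := by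
    simp [one_apply, Matrix.trace, ← Finset.mul_sum, hK]
  have hstar (a : κ) : ∑ i, ∑ j, (U a)ᴴ i j * (Z a)ᴴ i j = star (∑ i, ∑ j, U a i j * Z a i j) := by
    rw [Finset.sum_comm]
    simp [conjTranspose_apply]
  simp only [schurPairing_apply, dilationKernel, Fintype.sum_sum_type, fromBlocks_apply₁₁,
    fromBlocks_apply₁₂, fromBlocks_apply₂₁, fromBlocks_apply₂₂, Finset.sum_add_distrib, hdiag,
    hstar, star_sum]
  ring

theorem schurPairing_dilationKernel_nonneg_of_posDef {U : κ → Matrix ι ι ℂ}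
    (hU : IsTraceContractive U) {B : κ → Matrix (ι ⊕ ι) (ι ⊕ ι) ℂ} (hB : B ∈ constDiagBlocks κ ι)
    (hpos : ∀ a, (B a).PosDef) : 0 ≤ schurPairing (dilationKernel U) B := by
  obtain ⟨a₀⟩ := ‹Nonempty κ›
  have hX : (B a₀).toBlocks₁₁.PosDef := (hpos a₀).submatrix Sum.inl_injective
  have hY : (B a₀).toBlocks₂₂.PosDef := (hpos a₀).submatrix Sum.inr_injective
  obtain ⟨S, hS, hXS⟩ :=
    CStarAlgebra.isStrictlyPositive_iff_eq_star_mul_self.mp hX.isStrictlyPositive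
  obtain ⟨T, hT, hYT⟩ :=
    CStarAlgebra.isStrictlyPositive_iff_eq_star_mul_self.mp hY.isStrictlyPositive
  have hblock (a : κ) :
      B a = fromBlocks (Sᴴ * S) (B a).toBlocks₁₂ (B a).toBlocks₁₂ᴴ (Tᴴ * T) := by
    rw [← star_eq_conjTranspose S, ← star_eq_conjTranspose T, ← hXS, ← hYT]
    ext (i | i) (j | j)
    · exact (hB a a₀ i j).1
    · rfl
    · exact ((hpos a).isHermitian.apply _ _).symm
    · exact (hB a a₀ i j).2
  choose A hA hZ using fun a => exists_contraction_of_posSemidef_fromBlocks hS hT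
    (hblock a ▸ (hpos a).posSemidef)
  have hS0 := Complex.nonneg_iff.1 (posSemidef_conjTranspose_mul_self S).trace_nonneg
  have hT0 := Complex.nonneg_iff.1 (posSemidef_conjTranspose_mul_self T).trace_nonneg
  have hle := neg_le_of_abs_le ((Complex.abs_re_le_norm _).trans (hU A hA S T))
  rw [funext hblock, schurPairing_dilationKernel_fromBlocks, funext hZ, Complex.star_def,
    Complex.add_conj, Complex.nonneg_iff]
  simp only [Complex.add_re, Complex.add_im, Complex.ofReal_re, Complex.ofReal_im, ← hS0.2, ← hT0.2]
  constructor <;> linarith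

theorem schurPairing_dilationKernel_nonneg {U : κ → Matrix ι ι ℂ}
    (hU : IsTraceContractive U) {B : κ → Matrix (ι ⊕ ι) (ι ⊕ ι) ℂ} (hB : B ∈ constDiagBlocks κ ι)
    (hpos : 0 ≤ B) : 0 ≤ schurPairing (dilationKernel U) B := by
  have hlim : Filter.Tendsto (fun ε : ℝ => schurPairing (dilationKernel U) B +
      ε • schurPairing (dilationKernel U) 1) (𝓝[>] 0) (𝓝 (schurPairing (dilationKernel U) B)) := by
    refine Filter.Tendsto.mono_left ?_ nhdsWithin_le_nhds
    exact Continuous.tendsto' (by fun_prop) _ _ (by simp)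
  refine ge_of_tendsto hlim (eventually_mem_nhdsWithin.mono fun ε hε => ?_)
  rw [← LinearMap.map_smul_of_tower, ← map_add]
  have h1 : ε • (1 : κ → Matrix (ι ⊕ ι) (ι ⊕ ι) ℂ) ∈ constDiagBlocks κ ι :=
    const_mem_constDiagBlocks (ε • 1)
  have hε1 : (ε • (1 : Matrix (ι ⊕ ι) (ι ⊕ ι) ℂ)).PosDef := PosDef.one.smul hε
  exact schurPairing_dilationKernel_nonneg_of_posDef hU (add_mem hB h1) fun a =>
    PosDef.posSemidef_add (nonneg_iff_posSemidef.1 (hpos a)) hε1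

theorem exists_posSemidef_dilation {U : κ → Matrix ι ι ℂ} (hU : IsTraceContractive U) :
    ∃ R : κ → Matrix (ι ⊕ ι) (ι ⊕ ι) ℂ, (∀ a, (R a).PosSemidef) ∧
      (∀ a, (R a).toBlocks₁₂ = U a) ∧ (∑ a, R a).toBlocks₁₁ = 1 ∧ (∑ a, R a).toBlocks₂₂ = 1 := by
  classical
  obtain ⟨R, hR, hpair⟩ := exists_posSemidef_schurPairing_eq
    (L := constDiagBlocks κ ι) (f := (schurPairing (dilationKernel U)).domRestrict _)
    (fun _ => star_mem_constDiagBlocks) (const_mem_constDiagBlocks _)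
    (fun B hB => schurPairing_dilationKernel_nonneg hU B.2 hB)
  have hentry (a : κ) (i j : ι) : R a (.inl i) (.inr j) = U a i j := by
    have hmem : Pi.single a (Matrix.single (.inl i) (.inr j) 1) ∈ constDiagBlocks κ ι := by
      intro a₁ a₂ k l
      simp only [Pi.single_apply]
      split_ifs <;> simp
    simpa [schurPairing_single_single, dilationKernel] using hpair ⟨_, hmem⟩
  have hsum (p q : ι ⊕ ι) : (∑ a, R a) p q = (∑ a, dilationKernel U a) p q := by
    simpa [schurPairing_apply, Matrix.single_apply, Matrix.sum_apply, ite_and] using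
      hpair ⟨_, const_mem_constDiagBlocks (Matrix.single p q 1)⟩
  have hK : (Fintype.card κ : ℂ) ≠ 0 := Nat.cast_ne_zero.2 Fintype.card_ne_zero
  refine ⟨R, hR, fun a => ext fun i j => hentry a i j, ?_, ?_⟩ <;> ext i j <;>
  simp [toBlocks₁₁, toBlocks₂₂, hsum, Matrix.sum_apply, dilationKernel, hK]

end Dilation

section Polarization

open Matrix
open scoped ComplexOrder

variable {κ ι : Type*} [Fintype ι] [DecidableEq ι]

/-- The diagonal matrix `diag(1, z)` on the doubled space, a unitary when `‖z‖ = 1`. -/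
def phaseDiag (ι : Type*) [DecidableEq ι] (z : ℂ) : Matrix (ι ⊕ ι) (ι ⊕ ι) ℂ :=
  fromBlocks 1 0 0 (z • 1)

theorem phaseDiag_conj_fromBlocks (z : ℂ) (X Z W Y : Matrix ι ι ℂ) :
    (phaseDiag ι z)ᴴ * fromBlocks X Z W Y * phaseDiag ι z =
      fromBlocks X (z • Z) (star z • W) ((star z * z) • Y) := by
  simp [phaseDiag, fromBlocks_conjTranspose, fromBlocks_multiply, smul_smul, mul_comm]

theorem one_sub_half_phaseDiag_conj {z : ℂ} (hz : star z * z = 1)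
    {R : Matrix (ι ⊕ ι) (ι ⊕ ι) ℂ} (h₁₁ : R.toBlocks₁₁ = 1) (h₂₂ : R.toBlocks₂₂ = 1) :
    1 - (2 : ℂ)⁻¹ • ((phaseDiag ι z)ᴴ * R * phaseDiag ι z) =
      (2 : ℂ)⁻¹ • ((phaseDiag ι (-z))ᴴ * R * phaseDiag ι (-z)) := by
  have hz' : star (-z) * -z = 1 := by rw [star_neg, neg_mul_neg, hz]
  rw [← fromBlocks_toBlocks R, h₁₁, h₂₂, phaseDiag_conj_fromBlocks, phaseDiag_conj_fromBlocks,
    hz, hz', fromBlocks_smul, fromBlocks_smul, ← fromBlocks_one, sub_eq_iff_eq_add,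
    fromBlocks_add, star_neg]
  congr 1 <;> module

/-- Averaging against the fourth roots of unity isolates the upper right block. -/
theorem fromBlocks_toBlocks₁₂_eq_sum_phaseDiag_conj (R : Matrix (ι ⊕ ι) (ι ⊕ ι) ℂ) :
    fromBlocks 0 R.toBlocks₁₂ 0 0 = (2 : ℂ)⁻¹ • ∑ k : Fin 4, star (Complex.I ^ (k : ℕ)) •
      (2 : ℂ)⁻¹ • ((phaseDiag ι (Complex.I ^ (k : ℕ)))ᴴ * R *
        phaseDiag ι (Complex.I ^ (k : ℕ))) := by
  conv_rhs => rw [← fromBlocks_toBlocks R]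
  simp only [phaseDiag_conj_fromBlocks, Fin.sum_univ_four, fromBlocks_smul, fromBlocks_add,
    Fin.coe_ofNat_eq_mod, Nat.reduceMod, pow_zero, pow_one, Complex.I_sq, Complex.I_pow_three,
    Complex.star_def, map_one, map_neg, Complex.conj_I, neg_neg, smul_smul, mul_neg, neg_mul,
    mul_one, one_mul, mul_left_comm Complex.I, Complex.I_mul_I]
  congr 1 <;> module

theorem exists_povm_polarization [Fintype κ] {U : κ → Matrix ι ι ℂ}
    (hU : IsTraceContractive U) :
    ∃ E : Fin 4 → κ → Matrix (ι ⊕ ι) (ι ⊕ ι) ℂ,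
      (∀ k a, (E k a).PosSemidef) ∧ (∀ k, (1 - ∑ a, E k a).PosSemidef) ∧
      ∀ a, fromBlocks 0 (U a) 0 0 =
        (2 : ℂ)⁻¹ • ∑ k : Fin 4, star (Complex.I ^ (k : ℕ)) • E k a := by
  rcases isEmpty_or_nonempty κ with hκ | hκ
  · exact ⟨fun _ => hκ.elim, fun _ => hκ.elim, fun _ => by simpa using PosSemidef.one, hκ.elim⟩
  obtain ⟨R, hR, hRU, h₁₁, h₂₂⟩ := exists_posSemidef_dilation hU
  refine ⟨fun k a => (2 : ℂ)⁻¹ • ((phaseDiag ι (Complex.I ^ (k : ℕ)))ᴴ * R a *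
    phaseDiag ι (Complex.I ^ (k : ℕ))), fun k a => ?_, fun k => ?_, fun a => ?_⟩
  · exact ((hR a).conjTranspose_mul_mul_same _).smul (by positivity)
  · have hz : star (Complex.I ^ (k : ℕ)) * Complex.I ^ (k : ℕ) = 1 := by
      rw [Complex.star_def, Complex.conj_mul']
      simp
    rw [← Finset.smul_sum, ← Finset.sum_mul, ← Finset.mul_sum,
      one_sub_half_phaseDiag_conj hz h₁₁ h₂₂]
    exact ((posSemidef_sum _ fun a _ => hR a).conjTranspose_mul_mul_same _).smul (by positivity)
  · rw [← hRU, fromBlocks_toBlocks₁₂_eq_sum_phaseDiag_conj]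

end Polarization

section Trace

variable {H : Type*} [NormedAddCommGroup H] [InnerProductSpace ℂ H]

theorem hasSum_norm_inner_sq {ι : Type*} (b : HilbertBasis ι ℂ H) (x : H) :
    HasSum (fun i => ‖⟪b i, x⟫_ℂ‖ ^ 2) (‖x‖ ^ 2) := by
  have h := Complex.hasSum_re (b.hasSum_inner_mul_inner x x)
  convert h using 1
  · funext i
    rw [← inner_conj_symm x (b i), Complex.conj_mul']
    norm_cast
  · rw [inner_self_eq_norm_sq_to_K]
    norm_cast

theorem tsum_enorm_comp_sq_le {ι : Type*} (b : ι → H) (T A : H →L[ℂ] H) :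
    ∑' i, ‖T (A (b i))‖ₑ ^ 2 ≤ ‖T‖ₑ ^ 2 * ∑' i, ‖A (b i)‖ₑ ^ 2 := by
  rw [← ENNReal.tsum_mul_left]
  gcongr
  rw [← mul_pow]
  gcongr
  exact T.le_opENorm _

theorem norm_sum_inner_le_of_tsum_enorm_sq_le {ι : Type*} {c d : ℝ} (hc : 0 ≤ c) (hd : 0 ≤ d)
    {f g : ι → H} (hf : ∑' i, ‖f i‖ₑ ^ 2 ≤ .ofReal (c ^ 2))
    (hg : ∑' i, ‖g i‖ₑ ^ 2 ≤ .ofReal (d ^ 2)) (s : Finset ι) :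
    ‖∑ i ∈ s, ⟪f i, g i⟫_ℂ‖ ≤ c * d := by
  have hsum {h : ι → H} {r : ℝ} (hr : 0 ≤ r) (hh : ∑' i, ‖h i‖ₑ ^ 2 ≤ .ofReal (r ^ 2)) :
      √(∑ i ∈ s, ‖h i‖ ^ 2) ≤ r := by
    refine Real.sqrt_le_iff.2 ⟨hr, (ENNReal.ofReal_le_ofReal_iff (by positivity)).1 ?_⟩
    rw [ENNReal.ofReal_sum_of_nonneg fun _ _ => by positivity]
    simp only [ENNReal.ofReal_pow (norm_nonneg _), ofReal_norm]
    exact (ENNReal.sum_le_tsum s).trans hh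
  calc ‖∑ i ∈ s, ⟪f i, g i⟫_ℂ‖ ≤ ∑ i ∈ s, ‖f i‖ * ‖g i‖ :=
        (norm_sum_le _ _).trans (Finset.sum_le_sum fun i _ => norm_inner_le_norm _ _)
    _ ≤ √(∑ i ∈ s, ‖f i‖ ^ 2) * √(∑ i ∈ s, ‖g i‖ ^ 2) := Real.sum_mul_le_sqrt_mul_sqrt _ _ _
    _ ≤ c * d := by
        gcongr
        · exact hsum hc hf
        · exact hsum hd hg

variable [CompleteSpace H]

theorem tsum_enorm_adjoint_sq {ι : Type*} (b : HilbertBasis ι ℂ H) (A : H →L[ℂ] H) :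
    ∑' i, ‖ContinuousLinearMap.adjoint A (b i)‖ₑ ^ 2 = ∑' i, ‖A (b i)‖ₑ ^ 2 := by
  have hParseval (x : H) : ‖x‖ₑ ^ 2 = ∑' j, ‖⟪b j, x⟫_ℂ‖ₑ ^ 2 := by
    have h := hasSum_norm_inner_sq b x
    simp only [← ofReal_norm, ← ENNReal.ofReal_pow (norm_nonneg _)]
    rw [← h.tsum_eq, ENNReal.ofReal_tsum_of_nonneg (fun _ => by positivity) h.summable]
  simp only [hParseval (A _), hParseval (ContinuousLinearMap.adjoint A _)]
  rw [ENNReal.tsum_comm]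
  refine tsum_congr fun j => tsum_congr fun i => ?_
  rw [ContinuousLinearMap.adjoint_inner_right, ← inner_conj_symm, RCLike.enorm_conj]

theorem inner_apply_eq_inner_sqrt {A : H →L[ℂ] H} (hA : 0 ≤ A) (x y : H) :
    ⟪x, A y⟫_ℂ = ⟪CFC.sqrt A x, CFC.sqrt A y⟫_ℂ := by
  have hsa : ContinuousLinearMap.adjoint (CFC.sqrt A) = CFC.sqrt A :=
    (CFC.sqrt_nonneg A).isSelfAdjoint
  have hss : CFC.sqrt A ∘L CFC.sqrt A = A := CFC.sqrt_mul_sqrt_self A hA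
  conv_lhs => rw [← hss, ContinuousLinearMap.comp_apply, ← ContinuousLinearMap.adjoint_inner_left,
    hsa]

end Trace

section Density

variable {H : Type} [NormedAddCommGroup H] [InnerProductSpace ℂ H]

theorem hasTrace_comp_rankOne (T : H →L[ℂ] H) (ζ : H) :
    HasTrace (T ∘L InnerProductSpace.rankOne ℂ ζ ζ) ⟪ζ, T ζ⟫_ℂ := by
  intro ι b
  refine (b.hasSum_inner_mul_inner ζ (T ζ)).congr_fun fun i => ?_
  rw [ContinuousLinearMap.comp_apply, InnerProductSpace.rankOne_apply, map_smul, inner_smul_right]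

variable [CompleteSpace H]

theorem isDensity_rankOne {ζ : H} (hζ : ‖ζ‖ = 1) : IsDensity (InnerProductSpace.rankOne ℂ ζ ζ) := by
  refine ⟨?_, ?_⟩
  · rw [ContinuousLinearMap.nonneg_iff_isPositive]
    exact InnerProductSpace.isPositive_rankOne_self ζ
  · have h := hasTrace_comp_rankOne (.id ℂ H) ζ
    rwa [ContinuousLinearMap.id_comp, ContinuousLinearMap.id_apply, inner_self_eq_norm_sq_to_K,
      hζ, RCLike.ofReal_one, one_pow] at h

theorem IsDensity.tsum_enorm_sqrt_sq {ρ : H →L[ℂ] H} (hρ : IsDensity ρ) {ι : Type}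
    (b : HilbertBasis ι ℂ H) : ∑' i, ‖CFC.sqrt ρ (b i)‖ₑ ^ 2 = 1 := by
  have h : HasSum (fun i => ‖CFC.sqrt ρ (b i)‖ ^ 2) 1 := by
    refine (Complex.hasSum_re (hρ.2 ι b)).congr_fun fun i => ?_
    rw [inner_apply_eq_inner_sqrt hρ.1, inner_self_eq_norm_sq_to_K]
    norm_cast
  simp only [← ofReal_norm, ← ENNReal.ofReal_pow (norm_nonneg _)]
  rw [← ENNReal.ofReal_tsum_of_nonneg (fun _ => by positivity) h.summable, h.tsum_eq,
    ENNReal.ofReal_one]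

/-- Writing `ρ = √ρ √ρ`, the trace of `T ρ` is the Hilbert–Schmidt inner product of `√ρ T†`
and `√ρ`. -/
theorem norm_trace_comp_le {ρ T : H →L[ℂ] H} (hρ : IsDensity ρ) {t : ℂ}
    (ht : HasTrace (T ∘L ρ) t) : ‖t‖ ≤ ‖T‖ := by
  obtain ⟨w, b, -⟩ := exists_hilbertBasis ℂ H
  set s := CFC.sqrt ρ
  have hsa : ContinuousLinearMap.adjoint s = s := (CFC.sqrt_nonneg ρ).isSelfAdjoint
  have hs : ∑' i, ‖s (b i)‖ₑ ^ 2 = 1 := hρ.tsum_enorm_sqrt_sq b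
  have hTs : ∑' i, ‖s (ContinuousLinearMap.adjoint T (b i))‖ₑ ^ 2 ≤ .ofReal (‖T‖ ^ 2) :=
    calc ∑' i, ‖s (ContinuousLinearMap.adjoint T (b i))‖ₑ ^ 2 = ∑' i, ‖T (s (b i))‖ₑ ^ 2 := by
          have h := tsum_enorm_adjoint_sq b (T ∘L s)
          rwa [ContinuousLinearMap.adjoint_comp, hsa] at h
      _ ≤ ‖T‖ₑ ^ 2 * ∑' i, ‖s (b i)‖ₑ ^ 2 := tsum_enorm_comp_sq_le _ T s
      _ = .ofReal (‖T‖ ^ 2) := by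
          rw [hs, mul_one, ENNReal.ofReal_pow (norm_nonneg _), ofReal_norm]
  have hinner (i : w) : ⟪b i, (T ∘L ρ) (b i)⟫_ℂ =
      ⟪s (ContinuousLinearMap.adjoint T (b i)), s (b i)⟫_ℂ := by
    rw [ContinuousLinearMap.comp_apply, ← ContinuousLinearMap.adjoint_inner_left,
      inner_apply_eq_inner_sqrt hρ.1]
  refine le_of_tendsto (ht w b).norm (Filter.Eventually.of_forall fun F => ?_)
  have hs' : ∑' i, ‖s (b i)‖ₑ ^ 2 ≤ .ofReal (1 ^ 2) := by simp [hs]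
  simpa only [hinner, mul_one] using
    norm_sum_inner_le_of_tsum_enorm_sq_le (norm_nonneg T) zero_le_one hTs hs' F

end Density

section TensorOp

variable {H₁ H₂ : Type*} [NormedAddCommGroup H₁] [InnerProductSpace ℂ H₁]
  [NormedAddCommGroup H₂] [InnerProductSpace ℂ H₂]

theorem norm_completion_le {E F : Type*} [NormedAddCommGroup E] [NormedSpace ℂ E]
    [NormedAddCommGroup F] [NormedSpace ℂ F] (f : E →L[ℂ] F) : ‖f.completion‖ ≤ ‖f‖ := by
  refine ContinuousLinearMap.opNorm_le_bound _ (norm_nonneg _) fun x => ?_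
  induction x using UniformSpace.Completion.induction_on with
  | hp => exact isClosed_le (by fun_prop) (by fun_prop)
  | ih a =>
    rw [ContinuousLinearMap.completion_apply_coe, UniformSpace.Completion.norm_coe,
      UniformSpace.Completion.norm_coe]
    exact f.le_opNorm a

theorem norm_tensorOp_le (S : H₁ →L[ℂ] H₁) (T : H₂ →L[ℂ] H₂) : ‖tensorOp S T‖ ≤ ‖S‖ * ‖T‖ :=
  (norm_completion_le _).trans (TensorProduct.norm_mapL_le S T)

theorem tensorOp_coe_tmul (S : H₁ →L[ℂ] H₁) (T : H₂ →L[ℂ] H₂) (x : H₁) (y : H₂) :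
    tensorOp S T ((x ⊗ₜ[ℂ] y : H₁ ⊗[ℂ] H₂) : HilbertTensor H₁ H₂) =
      ((S x ⊗ₜ[ℂ] T y : H₁ ⊗[ℂ] H₂) : HilbertTensor H₁ H₂) := by
  rw [tensorOp, ContinuousLinearMap.completion_apply_coe, TensorProduct.mapL_tmul]

theorem tensorOpLin_tmul (S : H₁ →L[ℂ] H₁) (T : H₂ →L[ℂ] H₂) :
    tensorOpLin H₁ H₂ (S ⊗ₜ[ℂ] T) = tensorOp S T := rfl

theorem isSymmetric_map {S : H₁ →ₗ[ℂ] H₁} {T : H₂ →ₗ[ℂ] H₂} (hS : S.IsSymmetric)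
    (hT : T.IsSymmetric) : (TensorProduct.map S T).IsSymmetric := by
  intro a b
  induction a using TensorProduct.induction_on with
  | zero => simp
  | add a a' ha ha' => simp only [map_add, inner_add_left, ha, ha']
  | tmul x y =>
    induction b using TensorProduct.induction_on with
    | zero => simp
    | add b b' hb hb' => simp only [map_add, inner_add_right, hb, hb']
    | tmul x' y' => simp [hS x x', hT y y']

theorem inner_tensorOp_left_of_isSymmetric {S : H₁ →L[ℂ] H₁} {T : H₂ →L[ℂ] H₂}
    (hS : (S : H₁ →ₗ[ℂ] H₁).IsSymmetric) (hT : (T : H₂ →ₗ[ℂ] H₂).IsSymmetric)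
    (x y : HilbertTensor H₁ H₂) : ⟪tensorOp S T x, y⟫_ℂ = ⟪x, tensorOp S T y⟫_ℂ := by
  induction x, y using UniformSpace.Completion.induction_on₂ with
  | hp => exact isClosed_eq (by fun_prop) (by fun_prop)
  | ih a b =>
    simp only [tensorOp, ContinuousLinearMap.completion_apply_coe,
      UniformSpace.Completion.inner_coe]
    simpa only [TensorProduct.mapL_apply] using isSymmetric_map hS hT a b

end TensorOp

section BlockOp

open Matrix
open scoped Matrix.Norms.L2Operator

variable {H : Type*} [NormedAddCommGroup H] [InnerProductSpace ℂ H] {n : ℕ}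

theorem blockOp_apply (T : Matrix (Fin n) (Fin n) (H →L[ℂ] H)) (v : PiLp 2 fun _ : Fin n => H)
    (i : Fin n) : blockOp T v i = ∑ j, T i j (v j) := by
  simp [blockOp]

theorem blockOp_sum {ι : Type*} (s : Finset ι)
    (T : ι → Matrix (Fin n) (Fin n) (H →L[ℂ] H)) :
    blockOp (∑ k ∈ s, T k) = ∑ k ∈ s, blockOp (T k) := by
  ext v i
  simp only [blockOp_apply, Matrix.sum_apply, _root_.sum_apply, WithLp.ofLp_sum, Finset.sum_apply]
  rw [Finset.sum_comm]

theorem blockOp_mul (S T : Matrix (Fin n) (Fin n) (H →L[ℂ] H)) :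
    blockOp (S * T) = blockOp S ∘L blockOp T := by
  ext v i
  simp only [ContinuousLinearMap.comp_apply, blockOp_apply, Matrix.mul_apply, _root_.sum_apply,
    map_sum, mul_apply_eq_comp]
  rw [Finset.sum_comm]

theorem blockOp_diagonal_apply (r : H →L[ℂ] H) (v : PiLp 2 fun _ : Fin n => H) (l : Fin n) :
    blockOp (diagonal fun _ => r) v l = r (v l) := by
  rw [blockOp_apply, Fintype.sum_eq_single l fun j hj => by simp [hj.symm], diagonal_apply_eq]

theorem norm_sq_blockOp_diagonal (r : H →L[ℂ] H) (v : PiLp 2 fun _ : Fin n => H) :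
    ‖blockOp (diagonal fun _ => r) v‖ ^ 2 = ∑ l, ‖r (v l)‖ ^ 2 := by
  simp only [PiLp.norm_sq_eq_of_L2, blockOp_diagonal_apply]

theorem norm_le_norm_blockOp_one (T : H →L[ℂ] H) : ‖T‖ ≤ ‖blockOp (n := 1) (fun _ _ => T)‖ := by
  refine T.opNorm_le_bound (ContinuousLinearMap.opNorm_nonneg _) fun v => ?_
  have h := (blockOp (n := 1) (fun _ _ => T)).le_opNorm (WithLp.toLp 2 fun _ => v)
  have hentry := blockOp_apply (n := 1) (fun _ _ => T) (WithLp.toLp 2 fun _ => v) 0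
  simpa [PiLp.norm_eq_of_L2, hentry] using h

variable [CompleteSpace H]

theorem adjoint_blockOp (T : Matrix (Fin n) (Fin n) (H →L[ℂ] H)) :
    ContinuousLinearMap.adjoint (blockOp T) = blockOp Tᴴ := by
  symm
  rw [ContinuousLinearMap.eq_adjoint_iff]
  intro x y
  simp only [PiLp.inner_apply, blockOp_apply, inner_sum, sum_inner, conjTranspose_apply,
    ContinuousLinearMap.star_eq_adjoint, ContinuousLinearMap.adjoint_inner_left]
  rw [Finset.sum_comm]

/-- The action of scalar matrices on `ℓ₂ⁿ(H)`. -/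
def scalarBlockHom (n : ℕ) (H : Type*) [NormedAddCommGroup H] [InnerProductSpace ℂ H]
    [CompleteSpace H] : Matrix (Fin n) (Fin n) ℂ →⋆ₙₐ[ℂ]
      (PiLp 2 (fun _ : Fin n => H) →L[ℂ] PiLp 2 (fun _ : Fin n => H)) where
  toFun A := blockOp (A.map (algebraMap ℂ (H →L[ℂ] H)))
  map_smul' c A := by
    ext v i
    simp [blockOp_apply, Finset.smul_sum, mul_smul, Algebra.algebraMap_eq_smul_one]
  map_zero' := by
    ext v i
    simp [blockOp_apply]
  map_add' A B := by
    ext v i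
    simp [blockOp_apply, Finset.sum_add_distrib]
  map_mul' A B := by
    rw [Matrix.map_mul, blockOp_mul]
    rfl
  map_star' A := by
    rw [ContinuousLinearMap.star_eq_adjoint, adjoint_blockOp, star_eq_conjTranspose,
      conjTranspose_map _ fun z => algebraMap_star_comm z]

theorem norm_scalarBlockHom_le (A : Matrix (Fin n) (Fin n) ℂ) : ‖scalarBlockHom n H A‖ ≤ ‖A‖ :=
  NonUnitalStarAlgHom.norm_apply_le (scalarBlockHom n H) A

end BlockOp

section CompleteContraction

open Matrix
open scoped Matrix.Norms.L2Operator

theorem norm_sum_adjoint_comp_comp_le {ι E : Type*} [Fintype ι] [NormedAddCommGroup E]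
    [InnerProductSpace ℂ E] [CompleteSpace E] {R T : ι → E →L[ℂ] E} {c : ℝ} (hc : 0 ≤ c)
    (hR : ∀ x, ∑ a, ‖R a x‖ ^ 2 ≤ ‖x‖ ^ 2) (hT : ∀ a, ‖T a‖ ≤ c) :
    ‖∑ a, ContinuousLinearMap.adjoint (R a) ∘L T a ∘L R a‖ ≤ c := by
  refine ContinuousLinearMap.opNorm_le_of_re_inner_le hc fun x y hx hy => ?_
  have hsqrt {x : E} (hx : ‖x‖ = 1) : √(∑ a, ‖R a x‖ ^ 2) ≤ 1 :=
    Real.sqrt_le_one.2 ((hR x).trans (by simp [hx]))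
  have hterm (a : ι) : RCLike.re ⟪T a (R a x), R a y⟫_ℂ ≤ c * (‖R a x‖ * ‖R a y‖) :=
    calc RCLike.re ⟪T a (R a x), R a y⟫_ℂ ≤ ‖T a (R a x)‖ * ‖R a y‖ := re_inner_le_norm _ _
      _ ≤ c * ‖R a x‖ * ‖R a y‖ := by
          gcongr
          exact (T a).le_of_opNorm_le (hT a) _
      _ = c * (‖R a x‖ * ‖R a y‖) := mul_assoc _ _ _
  calc RCLike.re ⟪(∑ a, ContinuousLinearMap.adjoint (R a) ∘L T a ∘L R a) x, y⟫_ℂ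
      = ∑ a, RCLike.re ⟪T a (R a x), R a y⟫_ℂ := by
        simp [ContinuousLinearMap.adjoint_inner_left]
    _ ≤ ∑ a, c * (‖R a x‖ * ‖R a y‖) := Finset.sum_le_sum fun a _ => hterm a
    _ = c * ∑ a, ‖R a x‖ * ‖R a y‖ := by rw [Finset.mul_sum]
    _ ≤ c * (√(∑ a, ‖R a x‖ ^ 2) * √(∑ a, ‖R a y‖ ^ 2)) := by
        gcongr
        exact Real.sum_mul_le_sqrt_mul_sqrt _ _ _
    _ ≤ c * (1 * 1) := by
        gcongr
        · exact hsqrt hx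
        · exact hsqrt hy
    _ = c := by ring

variable {H : Type*} [NormedAddCommGroup H] [InnerProductSpace ℂ H] {N K : ℕ}

theorem norm_le_supNorms {n : ℕ} (A : Matrix (Fin n) (Fin n) (Fin K → ℂ)) (a : Fin K) :
    ‖A.map fun f => f a‖ ≤ supNorms K n A :=
  le_ciSup (f := fun k : Fin K => ‖toEuclideanCLM (n := Fin n) (𝕜 := ℂ) (A.map fun f => f k)‖)
    (Set.finite_range _).bddAbove a

theorem supNorms_nonneg {n : ℕ} (A : Matrix (Fin n) (Fin n) (Fin K → ℂ)) : 0 ≤ supNorms K n A :=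
  Real.iSup_nonneg fun _ => norm_nonneg _

variable [CompleteSpace H]

theorem sum_norm_sq_sqrt_apply_le {ι : Type*} [Fintype ι] {E : ι → (H →L[ℂ] H)}
    (hE : ∀ a, 0 ≤ E a) (hsum : ∑ a, E a ≤ 1) (x : H) :
    ∑ a, ‖CFC.sqrt (E a) x‖ ^ 2 ≤ ‖x‖ ^ 2 := by
  have hpos := ((ContinuousLinearMap.le_def _ _).1 hsum).re_inner_nonneg_right x
  have heq : ∑ a, ‖CFC.sqrt (E a) x‖ ^ 2 = RCLike.re ⟪x, (∑ a, E a) x⟫_ℂ := by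
    rw [_root_.sum_apply, inner_sum, map_sum]
    refine Finset.sum_congr rfl fun a _ => ?_
    rw [inner_apply_eq_inner_sqrt (hE a), inner_self_eq_norm_sq]
  rw [_root_.sub_apply, inner_sub_right, map_sub, one_apply_eq_self, inner_self_eq_norm_sq] at hpos
  linarith

theorem blockOp_map_linearCombination {n : ℕ} {E : Fin K → (H →L[ℂ] H)} (hE : ∀ a, 0 ≤ E a)
    (A : Matrix (Fin n) (Fin n) (Fin K → ℂ)) :
    blockOp (A.map (Fintype.linearCombination ℂ E)) =
      ∑ a, ContinuousLinearMap.adjoint (blockOp (diagonal fun _ => CFC.sqrt (E a))) ∘L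
        scalarBlockHom n H (A.map fun f => f a) ∘L blockOp (diagonal fun _ => CFC.sqrt (E a)) := by
  have hterm (a : Fin K) :
      ContinuousLinearMap.adjoint (blockOp (diagonal fun _ => CFC.sqrt (E a))) ∘L
          scalarBlockHom n H (A.map fun f => f a) ∘L
            blockOp (diagonal fun _ => CFC.sqrt (E a)) =
        blockOp ((A.map fun f => f a).map fun z => z • E a) := by
    have hsa : star (CFC.sqrt (E a)) = CFC.sqrt (E a) := (CFC.sqrt_nonneg (E a)).isSelfAdjoint
    rw [adjoint_blockOp, diagonal_conjTranspose]
    change _ ∘L blockOp ((A.map fun f => f a).map (algebraMap ℂ (H →L[ℂ] H))) ∘L _ = _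
    rw [← blockOp_mul, ← blockOp_mul]
    congr 1
    ext1 l k
    simp [hsa, Algebra.algebraMap_eq_smul_one, CFC.sqrt_mul_sqrt_self _ (hE a)]
  rw [Finset.sum_congr rfl fun a _ => hterm a, ← blockOp_sum]
  congr 1
  ext1 l k
  simp [Fintype.linearCombination_apply, Matrix.sum_apply]

/-- The map is `A ↦ ∑ √E_a A_a √E_a`, and the operators `√E_a` form a column contraction. -/
theorem isCompleteContraction_linearCombination {E : Fin K → (H →L[ℂ] H)} (hE : ∀ a, 0 ≤ E a)
    (hsum : ∑ a, E a ≤ 1) :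
    IsCompleteContraction (supNorms K) (opNorms H) (Fintype.linearCombination ℂ E) := by
  intro n A
  rw [opNorms, blockOp_map_linearCombination hE]
  refine norm_sum_adjoint_comp_comp_le (supNorms_nonneg A) (fun v => ?_)
    fun a => (norm_scalarBlockHom_le _).trans (norm_le_supNorms A a)
  simp only [norm_sq_blockOp_diagonal]
  rw [Finset.sum_comm, PiLp.norm_sq_eq_of_L2]
  exact Finset.sum_le_sum fun l _ => sum_norm_sq_sqrt_apply_le hE hsum (v l)

end CompleteContraction

section OneSum

variable {N : ℕ} {E F : Type*} [AddCommGroup E] [Module ℂ E] [AddCommGroup F] [Module ℂ F]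
  {ν : MatrixNorms E}

/-- The map `(e_i)_i ↦ ∑ u_i (e_i)` on an `ℓ₁`-sum. -/
def oneSumMap (u : Fin N → (E →ₗ[ℂ] F)) : PiLp 1 (fun _ : Fin N => E) →ₗ[ℂ] F :=
  LinearMap.lsum ℂ (fun _ => E) ℂ u ∘ₗ (WithLp.linearEquiv 1 ℂ (Fin N → E)).toLinearMap

theorem oneSumMap_apply (u : Fin N → (E →ₗ[ℂ] F)) (e : PiLp 1 (fun _ : Fin N => E)) :
    oneSumMap u e = ∑ i, u i (e i) := by
  simp [oneSumMap]

/-- The inclusion of the `x`-th summand. -/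
def oneSumIncl (x : Fin N) : E →ₗ[ℂ] PiLp 1 (fun _ : Fin N => E) :=
  (WithLp.linearEquiv 1 ℂ (Fin N → E)).symm.toLinearMap ∘ₗ LinearMap.single ℂ (fun _ => E) x

theorem oneSumMap_oneSumIncl (u : Fin N → (E →ₗ[ℂ] F)) (x : Fin N) (e : E) :
    oneSumMap u (oneSumIncl x e) = u x e := by
  rw [oneSumMap_apply, Fintype.sum_eq_single x fun i hi => by simp [oneSumIncl, hi]]
  simp [oneSumIncl]

theorem opNorms_map_oneSumMap_le {H : Type} [NormedAddCommGroup H] [InnerProductSpace ℂ H]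
    {u : Fin N → (E →ₗ[ℂ] (H →L[ℂ] H))}
    (hu : ∀ i, IsCompleteContraction ν (opNorms H) (u i)) (n : ℕ)
    (A : Matrix (Fin n) (Fin n) (PiLp 1 fun _ : Fin N => E)) :
    opNorms H n (A.map (oneSumMap u)) ≤ ∑ i, ν n (A.map fun e => e i) := by
  have hsum : A.map (oneSumMap u) = ∑ i, (A.map fun e => e i).map (u i) := by
    ext1 l k
    simp [oneSumMap_apply, Matrix.sum_apply]
  rw [hsum, opNorms, blockOp_sum]
  exact (norm_sum_le _ fun i => blockOp ((A.map fun e => e i).map (u i))).trans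
    (Finset.sum_le_sum fun i _ => hu i n (A.map fun e => e i))

theorem isCompleteContraction_oneSumMap {H : Type} [NormedAddCommGroup H]
    [InnerProductSpace ℂ H] [CompleteSpace H] {u : Fin N → (E →ₗ[ℂ] (H →L[ℂ] H))}
    (hu : ∀ i, IsCompleteContraction ν (opNorms H) (u i)) :
    IsCompleteContraction (oneSumNorms N ν) (opNorms H) (oneSumMap u) := by
  intro n A
  refine le_csSup ⟨∑ i, ν n (A.map fun e => e i), ?_⟩
    ⟨H, _, _, inferInstance, u, hu, by simp only [← oneSumMap_apply]⟩
  rintro _ ⟨H', _, _, _, u', hu', rfl⟩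
  simpa only [← oneSumMap_apply] using opNorms_map_oneSumMap_le hu' n A

theorem isCompleteContraction_comp_oneSumIncl {H : Type} [NormedAddCommGroup H]
    [InnerProductSpace ℂ H] (hν : ∀ n A, 0 ≤ ν n A)
    {u : PiLp 1 (fun _ : Fin N => E) →ₗ[ℂ] (H →L[ℂ] H)}
    (hu : IsCompleteContraction (oneSumNorms N ν) (opNorms H) u) (x : Fin N) :
    IsCompleteContraction ν (opNorms H) (u ∘ₗ oneSumIncl x) := by
  intro n A
  refine (hu n (A.map (oneSumIncl x))).trans (Real.sSup_le ?_ (hν n A))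
  rintro _ ⟨H', _, _, _, v, hv, rfl⟩
  refine le_of_eq_of_le ?_ (hv x n A)
  simp only [← oneSumMap_apply, Matrix.map_map, Function.comp_def, oneSumMap_oneSumIncl]

end OneSum

section BellForm

variable {N K : ℕ} {V W G : Type*} [AddCommGroup V] [Module ℂ V] [AddCommGroup W] [Module ℂ W]
  [AddCommGroup G] [Module ℂ G]

/-- The bilinear map `(S, T) ↦ ∑ M_{x,y}^{a,b} L (S_x^a ⊗ T_y^b)`. It is the Bell operator for
`L : B(H₁) ⊗ B(H₂) → B(H₁ ⊗ H₂)` and the value of a product strategy for `L : ℂ ⊗ ℂ → ℂ`. -/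
def bellForm (M : BellFunctional N K) (L : V ⊗[ℂ] W →ₗ[ℂ] G) :
    (Fin N → Fin K → V) →ₗ[ℂ] (Fin N → Fin K → W) →ₗ[ℂ] G :=
  ∑ x, ∑ y, ∑ a, ∑ b, M x y a b • (TensorProduct.curry L).compl₁₂
    (LinearMap.proj a ∘ₗ LinearMap.proj x) (LinearMap.proj b ∘ₗ LinearMap.proj y)

theorem bellForm_apply (M : BellFunctional N K) (L : V ⊗[ℂ] W →ₗ[ℂ] G)
    (S : Fin N → Fin K → V) (T : Fin N → Fin K → W) :
    bellForm M L S T = ∑ x, ∑ y, ∑ a, ∑ b, M x y a b • L (S x a ⊗ₜ T y b) := by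
  simp [bellForm]

theorem apply_map_bellTensor (M : BellFunctional N K) (L : V ⊗[ℂ] W →ₗ[ℂ] G)
    (u : L1Linf N K →ₗ[ℂ] V) (v : L1Linf N K →ₗ[ℂ] W) :
    L (TensorProduct.map u v (bellTensor M)) =
      bellForm M L (fun x a => u (basisVec x a)) (fun y b => v (basisVec y b)) := by
  simp only [bellTensor, bellForm_apply, map_sum, map_smul, TensorProduct.map_tmul]

end BellForm

section NormBounds

theorem norm_bellForm_le {N K : ℕ} {V W G : Type*} [SeminormedAddCommGroup V] [NormedSpace ℂ V]
    [SeminormedAddCommGroup W] [NormedSpace ℂ W] [SeminormedAddCommGroup G] [NormedSpace ℂ G]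
    (M : BellFunctional N K) {L : V ⊗[ℂ] W →ₗ[ℂ] G} (hL : ∀ v w, ‖L (v ⊗ₜ w)‖ ≤ ‖v‖ * ‖w‖)
    {S : Fin N → Fin K → V} {T : Fin N → Fin K → W} (hS : ∀ x a, ‖S x a‖ ≤ 1)
    (hT : ∀ y b, ‖T y b‖ ≤ 1) :
    ‖bellForm M L S T‖ ≤ ∑ x, ∑ y, ∑ a, ∑ b, ‖M x y a b‖ := by
  rw [bellForm_apply]
  refine norm_sum_le_of_le _ fun x _ => norm_sum_le_of_le _ fun y _ =>
    norm_sum_le_of_le _ fun a _ => norm_sum_le_of_le _ fun b _ => ?_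
  rw [norm_smul]
  exact mul_le_of_le_one_right (norm_nonneg _)
    ((hL _ _).trans (mul_le_one₀ (hS x a) (norm_nonneg _) (hT y b)))

theorem norm_map₂_sum_smul_le {κ V W G : Type*} [Fintype κ] [AddCommGroup V] [Module ℂ V]
    [AddCommGroup W] [Module ℂ W] [SeminormedAddCommGroup G] [NormedSpace ℂ G]
    (B : V →ₗ[ℂ] W →ₗ[ℂ] G) (c d : κ → ℂ) {S : κ → V} {T : κ → W} {r : ℝ}
    (h : ∀ k l, ‖B (S k) (T l)‖ ≤ r) :
    ‖B (∑ k, c k • S k) (∑ l, d l • T l)‖ ≤ (∑ k, ‖c k‖) * (∑ l, ‖d l‖) * r := by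
  have hexpand : B (∑ k, c k • S k) (∑ l, d l • T l) =
      ∑ k, ∑ l, (c k * d l) • B (S k) (T l) := by
    simp only [map_sum, map_smul, LinearMap.sum_apply, LinearMap.smul_apply, Finset.smul_sum]
    rw [Finset.sum_comm]
    simp only [smul_smul, mul_comm]
  rw [hexpand, Finset.sum_mul_sum, Finset.sum_mul]
  simp only [Finset.sum_mul]
  refine norm_sum_le_of_le _ fun k _ => norm_sum_le_of_le _ fun l _ => ?_
  rw [norm_smul, norm_mul]
  gcongr
  exact h _ _

end NormBounds

section BellOp

variable {N K : ℕ} {H₁ H₂ : Type*} [NormedAddCommGroup H₁] [InnerProductSpace ℂ H₁]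
  [NormedAddCommGroup H₂] [InnerProductSpace ℂ H₂]

/-- The Bell operator `∑ M_{x,y}^{a,b} S_x^a ⊗ T_y^b`, as a bilinear map in `S` and `T`. -/
def bellOp (M : BellFunctional N K) :
    (Fin N → Fin K → (H₁ →L[ℂ] H₁)) →ₗ[ℂ] (Fin N → Fin K → (H₂ →L[ℂ] H₂)) →ₗ[ℂ]
      (HilbertTensor H₁ H₂ →L[ℂ] HilbertTensor H₁ H₂) :=
  bellForm M (tensorOpLin H₁ H₂)

theorem inner_bellOp (M : BellFunctional N K) (S : Fin N → Fin K → (H₁ →L[ℂ] H₁))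
    (T : Fin N → Fin K → (H₂ →L[ℂ] H₂)) (ξ η : HilbertTensor H₁ H₂) :
    ⟪ξ, bellOp M S T η⟫_ℂ =
      ∑ x, ∑ y, ∑ a, ∑ b, M x y a b * ⟪ξ, tensorOp (S x a) (T y b) η⟫_ℂ := by
  simp only [bellOp, bellForm_apply, tensorOpLin_tmul, sum_apply, smul_apply, inner_sum,
    inner_smul_right]

theorem norm_bellOp_le (M : BellFunctional N K) {S : Fin N → Fin K → (H₁ →L[ℂ] H₁)}
    {T : Fin N → Fin K → (H₂ →L[ℂ] H₂)} (hS : ∀ x a, ‖S x a‖ ≤ 1) (hT : ∀ y b, ‖T y b‖ ≤ 1) :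
    ‖bellOp M S T‖ ≤ ∑ x, ∑ y, ∑ a, ∑ b, ‖M x y a b‖ :=
  norm_bellForm_le (G := HilbertTensor H₁ H₂ →L[ℂ] HilbertTensor H₁ H₂) M norm_tensorOp_le hS hT

end BellOp

section UpperBound

variable {N K : ℕ}

theorem norm_apply_basisVec_le_one {H : Type} [NormedAddCommGroup H] [InnerProductSpace ℂ H]
    {u : L1Linf N K →ₗ[ℂ] (H →L[ℂ] H)}
    (hu : IsCompleteContraction (l1LinfNorms N K) (opNorms H) u) (x : Fin N) (a : Fin K) :
    ‖u (basisVec x a)‖ ≤ 1 := by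
  let e : Matrix (Fin 1) (Fin 1) (Fin K → ℂ) := fun _ _ => Pi.single a 1
  have hsup : supNorms K 1 e ≤ 1 := by
    refine Real.iSup_le (fun k => ?_) zero_le_one
    have hdiag : (e.map fun f => f k) = Matrix.diagonal fun _ => (Pi.single a 1 : Fin K → ℂ) k := by
      ext i j
      rw [Subsingleton.elim i j, Matrix.diagonal_apply_eq]
      rfl
    rw [hdiag, ← Matrix.cstar_norm_def, Matrix.l2_opNorm_diagonal]
    exact (pi_norm_const_le _).trans ((norm_le_pi_norm _ k).trans (by simp [Pi.norm_single]))
  exact (norm_le_norm_blockOp_one _).trans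
    ((isCompleteContraction_comp_oneSumIncl (fun _ => supNorms_nonneg) hu x 1 e).trans hsup)

variable {H₁ H₂ : Type} [NormedAddCommGroup H₁] [InnerProductSpace ℂ H₁] [CompleteSpace H₁]
  [NormedAddCommGroup H₂] [InnerProductSpace ℂ H₂] [CompleteSpace H₂]

theorem norm_bellOp_le_bellMinNorm (M : BellFunctional N K)
    {u : L1Linf N K →ₗ[ℂ] (H₁ →L[ℂ] H₁)} {v : L1Linf N K →ₗ[ℂ] (H₂ →L[ℂ] H₂)}
    (hu : IsCompleteContraction (l1LinfNorms N K) (opNorms H₁) u)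
    (hv : IsCompleteContraction (l1LinfNorms N K) (opNorms H₂) v) :
    ‖bellOp M (fun x a => u (basisVec x a)) (fun y b => v (basisVec y b))‖ ≤ bellMinNorm M := by
  refine le_csSup ⟨∑ x : Fin N, ∑ y : Fin N, ∑ a, ∑ b, ‖M x y a b‖, ?_⟩
    ⟨H₁, _, _, inferInstance, H₂, _, _, inferInstance, u, v, hu, hv, ?_⟩
  · rintro _ ⟨H₁', _, _, _, H₂', _, _, _, u', v', hu', hv', rfl⟩
    rw [apply_map_bellTensor]
    exact norm_bellOp_le M (norm_apply_basisVec_le_one hu') (norm_apply_basisVec_le_one hv')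
  · rw [apply_map_bellTensor, bellOp]

theorem bellMinNorm_nonneg (M : BellFunctional N K) : 0 ≤ bellMinNorm M := by
  refine Real.sSup_nonneg ?_
  rintro _ ⟨_, _, _, _, _, _, _, _, _, _, _, _, rfl⟩
  exact ContinuousLinearMap.opNorm_nonneg _

theorem IsIncompletePOVM.exists_completeContraction {E : Fin N → Fin K → (H₁ →L[ℂ] H₁)}
    (hE : IsIncompletePOVM E) :
    ∃ u : L1Linf N K →ₗ[ℂ] (H₁ →L[ℂ] H₁),
      IsCompleteContraction (l1LinfNorms N K) (opNorms H₁) u ∧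
      (fun x a => u (basisVec x a)) = E := by
  refine ⟨oneSumMap fun x => Fintype.linearCombination ℂ (E x),
    isCompleteContraction_oneSumMap fun x =>
      isCompleteContraction_linearCombination (hE.1 x) (hE.2 x), ?_⟩
  funext x a
  exact (oneSumMap_oneSumIncl _ x _).trans (by simp)

variable {E : Fin N → Fin K → (H₁ →L[ℂ] H₁)} {F : Fin N → Fin K → (H₂ →L[ℂ] H₂)}

theorem norm_bellOp_le_bellMinNorm_of_isIncompletePOVM (M : BellFunctional N K)
    (hE : IsIncompletePOVM E) (hF : IsIncompletePOVM F) : ‖bellOp M E F‖ ≤ bellMinNorm M := by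
  obtain ⟨u, hu, rfl⟩ := hE.exists_completeContraction
  obtain ⟨v, hv, rfl⟩ := hF.exists_completeContraction
  exact norm_bellOp_le_bellMinNorm M hu hv

theorem IsIncompleteQuantum.norm_pairing_le_bellMinNorm (M : BellFunctional N K)
    {P : Behaviour N K} (hP : IsIncompleteQuantum P) : ‖pairing M P‖ ≤ bellMinNorm M := by
  obtain ⟨H₁, _, _, _, H₂, _, _, _, E, F, ρ, hE, hF, hρ, htrace⟩ := hP
  have hbell : HasTrace (bellOp M E F ∘L ρ) (pairing M P) := by
    intro ι b
    simp only [ContinuousLinearMap.comp_apply, inner_bellOp]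
    exact hasSum_sum fun x _ => hasSum_sum fun y _ => hasSum_sum fun a _ =>
      hasSum_sum fun b' _ => (htrace x y a b' ι b).mul_left (M x y a b')
  exact (norm_trace_comp_le hρ hbell).trans
    (norm_bellOp_le_bellMinNorm_of_isIncompletePOVM M hE hF)

theorem quantumBound_le_bellMinNorm (M : BellFunctional N K) :
    quantumBound M ≤ bellMinNorm M := by
  refine Real.sSup_le ?_ (bellMinNorm_nonneg M)
  rintro _ ⟨P, hP, rfl⟩
  exact hP.norm_pairing_le_bellMinNorm M

theorem IsIncompleteQuantum.norm_pairing_le_quantumBound (M : BellFunctional N K)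
    {P : Behaviour N K} (hP : IsIncompleteQuantum P) : ‖pairing M P‖ ≤ quantumBound M := by
  refine le_csSup ⟨bellMinNorm M, ?_⟩ ⟨P, hP, rfl⟩
  rintro _ ⟨P, hP, rfl⟩
  exact hP.norm_pairing_le_bellMinNorm M

theorem quantumBound_nonneg (M : BellFunctional N K) : 0 ≤ quantumBound M := by
  refine Real.sSup_nonneg ?_
  rintro _ ⟨_, _, rfl⟩
  exact norm_nonneg _

theorem IsIncompletePOVM.ofReal_re_inner_tensorOp (hE : IsIncompletePOVM E)
    (hF : IsIncompletePOVM F) (ζ : HilbertTensor H₁ H₂) (x y : Fin N) (a b : Fin K) :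
    ((⟪ζ, tensorOp (E x a) (F y b) ζ⟫_ℂ).re : ℂ) = ⟪ζ, tensorOp (E x a) (F y b) ζ⟫_ℂ := by
  have hEsymm := ((ContinuousLinearMap.nonneg_iff_isPositive _).1 (hE.1 x a)).isSymmetric
  have hFsymm := ((ContinuousLinearMap.nonneg_iff_isPositive _).1 (hF.1 y b)).isSymmetric
  rw [← Complex.conj_eq_iff_re, inner_conj_symm]
  exact inner_tensorOp_left_of_isSymmetric hEsymm hFsymm ζ ζ

theorem IsIncompletePOVM.isIncompleteQuantum_of_norm_eq_one (hE : IsIncompletePOVM E)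
    (hF : IsIncompletePOVM F) {ζ : HilbertTensor H₁ H₂} (hζ : ‖ζ‖ = 1) :
    IsIncompleteQuantum fun x y a b => (⟪ζ, tensorOp (E x a) (F y b) ζ⟫_ℂ).re := by
  refine ⟨H₁, _, _, inferInstance, H₂, _, _, inferInstance, E, F,
    InnerProductSpace.rankOne ℂ ζ ζ, hE, hF, isDensity_rankOne hζ, fun x y a b => ?_⟩
  rw [hE.ofReal_re_inner_tensorOp hF]
  exact hasTrace_comp_rankOne _ ζ

theorem norm_inner_bellOp_le_of_norm_eq_one (M : BellFunctional N K) (hE : IsIncompletePOVM E)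
    (hF : IsIncompletePOVM F) {ζ : HilbertTensor H₁ H₂} (hζ : ‖ζ‖ = 1) :
    ‖⟪ζ, bellOp M E F ζ⟫_ℂ‖ ≤ quantumBound M := by
  have h := (hE.isIncompleteQuantum_of_norm_eq_one hF hζ).norm_pairing_le_quantumBound M
  simpa only [inner_bellOp, pairing, hE.ofReal_re_inner_tensorOp hF] using h

theorem norm_inner_bellOp_le (M : BellFunctional N K) (hE : IsIncompletePOVM E)
    (hF : IsIncompletePOVM F) (ζ : HilbertTensor H₁ H₂) :
    ‖⟪ζ, bellOp M E F ζ⟫_ℂ‖ ≤ quantumBound M * ‖ζ‖ ^ 2 := by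
  rcases eq_or_ne ζ 0 with rfl | hζ
  · simp
  have h := norm_inner_bellOp_le_of_norm_eq_one M hE hF (norm_smul_inv_norm (𝕜 := ℂ) hζ)
  rw [map_smul, inner_smul_left, inner_smul_right, norm_mul, norm_mul, RCLike.norm_conj, norm_inv,
    RCLike.norm_ofReal, abs_norm] at h
  rw [← div_le_iff₀ (pow_pos (norm_pos_iff.2 hζ) 2)]
  refine le_of_eq_of_le ?_ h
  field_simp

end UpperBound

section Coordinates

open Matrix

variable {H : Type*} [NormedAddCommGroup H] [InnerProductSpace ℂ H] {ι : Type*}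

/-- The matrix of the compression of `S` to the span of the family `f`. -/
def compression (f : ι → H) (S : H →L[ℂ] H) : Matrix ι ι ℂ :=
  of fun i j => ⟪f i, S (f j)⟫_ℂ

theorem compression_id [DecidableEq ι] {f : ι → H} (hf : Orthonormal ℂ f) :
    compression f (.id ℂ H) = 1 := by
  ext i j
  simp [compression, orthonormal_iff_ite.1 hf, one_apply]

theorem compression_single_toEuclideanCLM [Fintype ι] [DecidableEq ι] (A : Matrix ι ι ℂ) :
    compression (fun i => EuclideanSpace.single i (1 : ℂ)) (toEuclideanCLM (𝕜 := ℂ) A) = A := by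
  ext i j
  rw [compression, of_apply, EuclideanSpace.inner_single_left, ofLp_toEuclideanCLM]
  simp

variable {H₁ H₂ : Type*} [NormedAddCommGroup H₁] [InnerProductSpace ℂ H₁]
  [NormedAddCommGroup H₂] [InnerProductSpace ℂ H₂] {κ : Type*} [Fintype ι] [Fintype κ]

/-- The vector `∑ z_{ip} f_i ⊗ g_p` with coefficient matrix `z`. -/
def coordVec (f : ι → H₁) (g : κ → H₂) (z : Matrix ι κ ℂ) : HilbertTensor H₁ H₂ :=
  ∑ i, ∑ p, z i p • ((f i ⊗ₜ[ℂ] g p : H₁ ⊗[ℂ] H₂) : HilbertTensor H₁ H₂)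

theorem inner_coordVec_tensorOp (f : ι → H₁) (g : κ → H₂) (z w : Matrix ι κ ℂ)
    (S : H₁ →L[ℂ] H₁) (T : H₂ →L[ℂ] H₂) :
    ⟪coordVec f g z, tensorOp S T (coordVec f g w)⟫_ℂ =
      (zᴴ * compression f S * w * (compression g T)ᵀ).trace := by
  have hlhs : ⟪coordVec f g z, tensorOp S T (coordVec f g w)⟫_ℂ = ∑ i, ∑ p, ∑ j, ∑ q,
      zᴴ p i * compression f S i j * w j q * (compression g T)ᵀ q p := by
    simp only [coordVec, map_sum, map_smul, tensorOp_coe_tmul, sum_inner, inner_smul_left]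
    simp only [inner_sum, inner_smul_right, Finset.mul_sum, UniformSpace.Completion.inner_coe,
      TensorProduct.inner_tmul, conjTranspose_apply, transpose_apply, compression, of_apply,
      starRingEnd_apply]
    congr! 4
    ring
  simp only [hlhs, trace, diag_apply, mul_apply, Finset.sum_mul]
  rw [Finset.sum_comm]
  refine Finset.sum_congr rfl fun p _ => ?_
  rw [Finset.sum_comm, Finset.sum_congr rfl fun j _ => Finset.sum_comm, Finset.sum_comm]

theorem tensorOp_id_id : tensorOp (.id ℂ H₁) (.id ℂ H₂) = .id ℂ (HilbertTensor H₁ H₂) := by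
  ext x
  induction x using UniformSpace.Completion.induction_on with
  | hp => exact isClosed_eq (by fun_prop) (by fun_prop)
  | ih a => simp [tensorOp]

theorem norm_sq_coordVec {f : ι → H₁} {g : κ → H₂} (hf : Orthonormal ℂ f)
    (hg : Orthonormal ℂ g) (z : Matrix ι κ ℂ) :
    ‖coordVec f g z‖ ^ 2 = (zᴴ * z).trace.re := by
  classical
  have h := inner_coordVec_tensorOp f g z z (.id ℂ H₁) (.id ℂ H₂)
  rw [tensorOp_id_id, ContinuousLinearMap.id_apply, compression_id hf, compression_id hg,
    transpose_one, Matrix.mul_one, Matrix.mul_one] at h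
  rw [← h, ← inner_self_eq_norm_sq (𝕜 := ℂ)]
  rfl

/-- The corners `fromBlocks 0 A 0 0` only see `z` on the left and `w` on the right, so an
off-diagonal matrix coefficient becomes a diagonal one on the doubled spaces. -/
theorem inner_coordVec_fromBlocks_tensorOp [DecidableEq ι] [DecidableEq κ] (f : ι → H₁)
    (g : κ → H₂) (z w : Matrix ι κ ℂ) (S : H₁ →L[ℂ] H₁) (T : H₂ →L[ℂ] H₂) :
    ⟪coordVec (fun i => EuclideanSpace.single i (1 : ℂ)) (fun p => EuclideanSpace.single p (1 : ℂ))
        (fromBlocks z 0 0 w),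
      tensorOp (toEuclideanCLM (𝕜 := ℂ) (fromBlocks 0 (compression f S) 0 0))
        (toEuclideanCLM (𝕜 := ℂ) (fromBlocks 0 (compression g T) 0 0))
        (coordVec (fun i => EuclideanSpace.single i (1 : ℂ))
          (fun p => EuclideanSpace.single p (1 : ℂ)) (fromBlocks z 0 0 w))⟫_ℂ =
    ⟪coordVec f g z, tensorOp S T (coordVec f g w)⟫_ℂ := by
  simp only [inner_coordVec_tensorOp, compression_single_toEuclideanCLM]
  simp [fromBlocks_conjTranspose, fromBlocks_transpose, fromBlocks_multiply, trace,
    Fintype.sum_sum_type]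

theorem norm_sq_coordVec_fromBlocks [DecidableEq ι] [DecidableEq κ] {f : ι → H₁} {g : κ → H₂}
    (hf : Orthonormal ℂ f) (hg : Orthonormal ℂ g) (z w : Matrix ι κ ℂ) :
    ‖coordVec (fun i => EuclideanSpace.single i (1 : ℂ)) (fun p => EuclideanSpace.single p (1 : ℂ))
        (fromBlocks z 0 0 w)‖ ^ 2 = ‖coordVec f g z‖ ^ 2 + ‖coordVec f g w‖ ^ 2 := by
  rw [norm_sq_coordVec EuclideanSpace.orthonormal_single EuclideanSpace.orthonormal_single,
    norm_sq_coordVec hf hg, norm_sq_coordVec hf hg]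
  simp [fromBlocks_conjTranspose, fromBlocks_multiply, trace,
    Fintype.sum_sum_type]

theorem mapIncl_eq_coordVec {E : Submodule ℂ H₁} {F : Submodule ℂ H₂}
    (e : OrthonormalBasis ι ℂ E) (e' : OrthonormalBasis κ ℂ F) (ζ : E ⊗[ℂ] F) :
    ((TensorProduct.mapIncl E F ζ : H₁ ⊗[ℂ] H₂) : HilbertTensor H₁ H₂) =
      coordVec (fun i => (e i : H₁)) (fun p => (e' p : H₂))
        (of fun i p => (e.tensorProduct e').repr ζ (i, p)) := by
  let coe : (H₁ ⊗[ℂ] H₂) →L[ℂ] HilbertTensor H₁ H₂ := UniformSpace.Completion.toComplL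
  change coe (TensorProduct.mapIncl E F ζ) = ∑ i, ∑ p, _ • coe _
  conv_lhs => rw [← (e.tensorProduct e').sum_repr ζ, map_sum, map_sum, Fintype.sum_prod_type]
  simp only [map_smul, OrthonormalBasis.tensorProduct_apply, TensorProduct.mapIncl,
    TensorProduct.map_tmul, Submodule.subtype_apply, of_apply]

theorem exists_orthonormal_coordVec_pair (ξ η : H₁ ⊗[ℂ] H₂) :
    ∃ (n m : ℕ) (f : Fin n → H₁) (g : Fin m → H₂) (z w : Matrix (Fin n) (Fin m) ℂ),
      Orthonormal ℂ f ∧ Orthonormal ℂ g ∧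
      (ξ : HilbertTensor H₁ H₂) = coordVec f g z ∧ (η : HilbertTensor H₁ H₂) = coordVec f g w := by
  obtain ⟨E, F, _, _, hmem⟩ :=
    TensorProduct.exists_finite_submodule_of_setFinite {ξ, η} (Set.toFinite _)
  obtain ⟨ξ', rfl⟩ := hmem (Set.mem_insert _ _)
  obtain ⟨η', rfl⟩ := hmem (Set.mem_insert_of_mem _ rfl)
  let e := stdOrthonormalBasis ℂ E
  let e' := stdOrthonormalBasis ℂ F
  exact ⟨_, _, _, _, _, _, e.orthonormal.comp_linearIsometry E.subtypeₗᵢ,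
    e'.orthonormal.comp_linearIsometry F.subtypeₗᵢ, mapIncl_eq_coordVec e e' ξ',
    mapIncl_eq_coordVec e e' η'⟩

end Coordinates

section Compression

open Matrix

variable {H : Type*} [NormedAddCommGroup H] [InnerProductSpace ℂ H] {n : ℕ} {ι : Type*}
  [Fintype ι]

/-- The vector of `ℓ₂ⁿ(H)` with entries `∑ S_{li} f_i`. -/
def combVec (f : ι → H) (S : Matrix (Fin n) ι ℂ) : PiLp 2 fun _ : Fin n => H :=
  WithLp.toLp 2 fun l => ∑ i, S l i • f i

theorem inner_combVec_blockOp_diagonal (f : ι → H) (S T : Matrix (Fin n) ι ℂ) (B : H →L[ℂ] H) :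
    ⟪combVec f S, blockOp (diagonal fun _ => B) (combVec f T)⟫_ℂ =
      ∑ i, ∑ j, compression f B i j * (Sᴴ * T) i j := by
  have hentry (l : Fin n) : ⟪combVec f S l, B (combVec f T l)⟫_ℂ =
      ∑ i, ∑ j, compression f B i j * (Sᴴ i l * T l j) := by
    simp only [combVec, map_sum, map_smul, sum_inner, inner_smul_left]
    simp only [inner_sum, inner_smul_right, Finset.mul_sum, compression, of_apply,
      conjTranspose_apply, starRingEnd_apply]
    congr! 2
    ring
  simp only [PiLp.inner_apply, blockOp_diagonal_apply, hentry, mul_apply, Finset.mul_sum]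
  rw [Finset.sum_comm]
  exact Finset.sum_congr rfl fun i _ => Finset.sum_comm

theorem blockOp_algebraMap_combVec (f : ι → H) (A : Matrix (Fin n) (Fin n) ℂ)
    (T : Matrix (Fin n) ι ℂ) :
    blockOp (A.map (algebraMap ℂ (H →L[ℂ] H))) (combVec f T) = combVec f (A * T) := by
  ext l
  simp only [blockOp_apply, combVec, map_apply, Algebra.algebraMap_eq_smul_one,
    _root_.smul_apply, one_apply_eq_self, Finset.smul_sum, smul_smul, mul_apply, Finset.sum_smul]
  exact Finset.sum_comm

theorem norm_sq_combVec {f : ι → H} (hf : Orthonormal ℂ f) (S : Matrix (Fin n) ι ℂ) :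
    ‖combVec f S‖ ^ 2 = (Sᴴ * S).trace.re := by
  rw [PiLp.norm_sq_eq_of_L2, trace_mul_comm, trace, Complex.re_sum]
  refine Finset.sum_congr rfl fun l _ => ?_
  rw [← inner_self_eq_norm_sq (𝕜 := ℂ), combVec, hf.inner_sum, diag_apply, mul_apply]
  simp only [conjTranspose_apply, starRingEnd_apply, mul_comm]
  rfl

theorem map_eq_sum_smul_single {K : ℕ} {V : Type*} [AddCommGroup V] [Module ℂ V]
    (u : (Fin K → ℂ) →ₗ[ℂ] V) (e : Fin K → ℂ) : u e = ∑ a, e a • u (Pi.single a 1) := by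
  conv_lhs => rw [← (Pi.basisFun ℂ (Fin K)).sum_repr e, map_sum]
  simp

theorem blockOp_map_eq_sum {K : ℕ} (u : (Fin K → ℂ) →ₗ[ℂ] (H →L[ℂ] H))
    (A : Matrix (Fin n) (Fin n) (Fin K → ℂ)) :
    blockOp (A.map u) = ∑ a, blockOp (diagonal fun _ => u (Pi.single a 1)) ∘L
      blockOp ((A.map fun e => e a).map (algebraMap ℂ (H →L[ℂ] H))) := by
  simp only [← blockOp_mul, ← blockOp_sum]
  congr 1
  ext1 l k
  rw [map_apply, map_eq_sum_smul_single, Matrix.sum_apply]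
  simp only [diagonal_mul, map_apply, Algebra.algebraMap_eq_smul_one, mul_smul_comm,
    mul_one]

theorem inner_combVec_blockOp_map {K : ℕ} (u : (Fin K → ℂ) →ₗ[ℂ] (H →L[ℂ] H))
    (A : Matrix (Fin n) (Fin n) (Fin K → ℂ)) (f : ι → H) (S T : Matrix (Fin n) ι ℂ) :
    ⟪combVec f S, blockOp (A.map u) (combVec f T)⟫_ℂ =
      schurPairing (fun a => compression f (u (Pi.single a 1)))
        fun a => Sᴴ * (A.map fun e => e a) * T := by
  rw [blockOp_map_eq_sum, _root_.sum_apply, inner_sum, schurPairing_apply]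
  refine Finset.sum_congr rfl fun a _ => ?_
  rw [ContinuousLinearMap.comp_apply, blockOp_algebraMap_combVec, inner_combVec_blockOp_diagonal,
    Matrix.mul_assoc]

/-- Complete contractivity tested on the vectors `combVec f S` and `combVec f T`. -/
theorem IsCompleteContraction.isTraceContractive_compression {K : ℕ}
    {u : (Fin K → ℂ) →ₗ[ℂ] (H →L[ℂ] H)}
    (hu : IsCompleteContraction (supNorms K) (opNorms H) u) {f : Fin n → H}
    (hf : Orthonormal ℂ f) :
    IsTraceContractive fun a => compression f (u (Pi.single a 1)) := by
  intro A hA S T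
  let A' : Matrix (Fin n) (Fin n) (Fin K → ℂ) := of fun l k a => A a l k
  have hnorm : ‖blockOp (A'.map u)‖ ≤ 1 :=
    (hu n A').trans (Real.iSup_le hA zero_le_one)
  calc _ = ‖⟪combVec f S, blockOp (A'.map u) (combVec f T)⟫_ℂ‖ := by
        rw [inner_combVec_blockOp_map]
        rfl
    _ ≤ ‖combVec f S‖ * ‖blockOp (A'.map u) (combVec f T)‖ := norm_inner_le_norm _ _
    _ ≤ ‖combVec f S‖ * (1 * ‖combVec f T‖) := by
        gcongr
        exact (blockOp (A'.map u)).le_of_opNorm_le hnorm _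
    _ ≤ (‖combVec f S‖ ^ 2 + ‖combVec f T‖ ^ 2) / 2 := by
        linarith [two_mul_le_add_sq ‖combVec f S‖ ‖combVec f T‖]
    _ = _ := by rw [norm_sq_combVec hf, norm_sq_combVec hf]

end Compression

section LowerBound

open Matrix

open scoped ComplexOrder MatrixOrder in
theorem toEuclideanCLM_nonneg {ι : Type*} [Fintype ι] [DecidableEq ι] {A : Matrix ι ι ℂ}
    (hA : A.PosSemidef) : 0 ≤ toEuclideanCLM (n := ι) (𝕜 := ℂ) A := by
  obtain ⟨C, rfl⟩ := CStarAlgebra.nonneg_iff_eq_star_mul_self.mp hA.nonneg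
  rw [map_mul, map_star]
  exact star_mul_self_nonneg _

open scoped ComplexOrder in
theorem isIncompletePOVM_toEuclideanCLM {ι : Type} [Fintype ι] [DecidableEq ι] {N K : ℕ}
    {E : Fin N → Fin K → Matrix ι ι ℂ} (hpos : ∀ x a, (E x a).PosSemidef)
    (hsum : ∀ x, (1 - ∑ a, E x a).PosSemidef) :
    IsIncompletePOVM fun x a => toEuclideanCLM (n := ι) (𝕜 := ℂ) (E x a) := by
  refine ⟨fun x a => toEuclideanCLM_nonneg (hpos x a), fun x => ?_⟩
  simpa only [map_sub, map_one, map_sum, sub_nonneg] using toEuclideanCLM_nonneg (hsum x)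

theorem exists_povm_polarization_of_isCompleteContraction {N K n : ℕ} {H : Type}
    [NormedAddCommGroup H] [InnerProductSpace ℂ H] {u : L1Linf N K →ₗ[ℂ] (H →L[ℂ] H)}
    (hu : IsCompleteContraction (l1LinfNorms N K) (opNorms H) u) {f : Fin n → H}
    (hf : Orthonormal ℂ f) :
    ∃ (c : Fin 4 → ℂ) (E : Fin 4 → Fin N → Fin K →
      (EuclideanSpace ℂ (Fin n ⊕ Fin n) →L[ℂ] EuclideanSpace ℂ (Fin n ⊕ Fin n))),
      (∀ k, ‖c k‖ = 1 / 2) ∧ (∀ k, IsIncompletePOVM (E k)) ∧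
      (fun x a => toEuclideanCLM (𝕜 := ℂ)
        (fromBlocks 0 (compression f (u (basisVec x a))) 0 0)) = ∑ k, c k • E k := by
  have hx (x : Fin N) := exists_povm_polarization
    (isCompleteContraction_comp_oneSumIncl (fun _ => supNorms_nonneg) hu x
      |>.isTraceContractive_compression hf)
  choose E hpos hsum hpolar using hx
  refine ⟨fun k => 2⁻¹ * star (Complex.I ^ (k : ℕ)), fun k x a => toEuclideanCLM (𝕜 := ℂ) (E x k a),
    fun k => by simp, fun k => isIncompletePOVM_toEuclideanCLM (fun x => hpos x k)
      fun x => hsum x k, ?_⟩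
  funext x a
  change toEuclideanCLM (𝕜 := ℂ) (fromBlocks 0 (compression f
    (u (oneSumIncl x (Pi.single a 1)))) 0 0) = _
  simp only [Finset.sum_apply, Pi.smul_apply, mul_smul, ← Finset.smul_sum, ← map_smul, ← map_sum]
  exact congrArg _ (hpolar x a)

variable {N K : ℕ} {H₁ H₂ : Type} [NormedAddCommGroup H₁] [InnerProductSpace ℂ H₁]
  [NormedAddCommGroup H₂] [InnerProductSpace ℂ H₂]

theorem norm_inner_bellOp_sum_smul_le [CompleteSpace H₁] [CompleteSpace H₂]
    (M : BellFunctional N K) {κ : Type*} [Fintype κ] (c d : κ → ℂ)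
    {E : κ → Fin N → Fin K → (H₁ →L[ℂ] H₁)} {F : κ → Fin N → Fin K → (H₂ →L[ℂ] H₂)}
    (hE : ∀ k, IsIncompletePOVM (E k)) (hF : ∀ k, IsIncompletePOVM (F k))
    (ζ : HilbertTensor H₁ H₂) :
    ‖⟪ζ, bellOp M (∑ k, c k • E k) (∑ l, d l • F l) ζ⟫_ℂ‖ ≤
      (∑ k, ‖c k‖) * (∑ l, ‖d l‖) * (quantumBound M * ‖ζ‖ ^ 2) :=
  norm_map₂_sum_smul_le ((bellOp M).compr₂ (innerSL ℂ ζ ∘L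
    ContinuousLinearMap.apply ℂ (HilbertTensor H₁ H₂) ζ).toLinearMap) c d
    fun k l => norm_inner_bellOp_le M (hE k) (hF l) ζ

theorem norm_inner_bellOp_coe_le (M : BellFunctional N K)
    {u : L1Linf N K →ₗ[ℂ] (H₁ →L[ℂ] H₁)} {v : L1Linf N K →ₗ[ℂ] (H₂ →L[ℂ] H₂)}
    (hu : IsCompleteContraction (l1LinfNorms N K) (opNorms H₁) u)
    (hv : IsCompleteContraction (l1LinfNorms N K) (opNorms H₂) v) (ξ η : H₁ ⊗[ℂ] H₂) :
    ‖⟪(ξ : HilbertTensor H₁ H₂),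
      bellOp M (fun x a => u (basisVec x a)) (fun y b => v (basisVec y b)) η⟫_ℂ‖ ≤
      4 * quantumBound M *
        (‖(ξ : HilbertTensor H₁ H₂)‖ ^ 2 + ‖(η : HilbertTensor H₁ H₂)‖ ^ 2) := by
  obtain ⟨n, m, f, g, z, w, hf, hg, hξ, hη⟩ := exists_orthonormal_coordVec_pair ξ η
  obtain ⟨c, E, hc, hE, hEu⟩ := exists_povm_polarization_of_isCompleteContraction hu hf
  obtain ⟨d, F, hd, hF, hFv⟩ := exists_povm_polarization_of_isCompleteContraction hv hg
  rw [hξ, hη, ← norm_sq_coordVec_fromBlocks hf hg]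
  set ζ := coordVec (fun i => EuclideanSpace.single i (1 : ℂ))
    (fun p => EuclideanSpace.single p (1 : ℂ)) (fromBlocks z 0 0 w) with hζ
  have hdoubled : ⟪coordVec f g z, bellOp M (fun x a => u (basisVec x a))
      (fun y b => v (basisVec y b)) (coordVec f g w)⟫_ℂ =
      ⟪ζ, bellOp M (∑ k, c k • E k) (∑ l, d l • F l) ζ⟫_ℂ := by
    simp only [← hEu, ← hFv, hζ, inner_bellOp, inner_coordVec_fromBlocks_tensorOp]
  rw [hdoubled]
  refine (norm_inner_bellOp_sum_smul_le M c d hE hF ζ).trans_eq ?_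
  norm_num [hc, hd]
  ring

theorem opNorm_le_of_norm_inner_le_add {E : Type*} [NormedAddCommGroup E]
    [InnerProductSpace ℂ E] {T : E →L[ℂ] E} {C : ℝ} (hC : 0 ≤ C)
    (h : ∀ x y, ‖⟪x, T y⟫_ℂ‖ ≤ C * (‖x‖ ^ 2 + ‖y‖ ^ 2)) : ‖T‖ ≤ 2 * C := by
  refine ContinuousLinearMap.opNorm_le_of_re_inner_le (𝕜 := ℂ) (by positivity)
    fun x y hx hy => ?_
  calc RCLike.re ⟪T x, y⟫_ℂ ≤ ‖⟪T x, y⟫_ℂ‖ := RCLike.re_le_norm _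
    _ = ‖⟪y, T x⟫_ℂ‖ := norm_inner_symm _ _
    _ ≤ C * (‖y‖ ^ 2 + ‖x‖ ^ 2) := h y x
    _ = 2 * C := by rw [hx, hy]; ring

theorem bellMinNorm_le_eight_mul_quantumBound (M : BellFunctional N K) :
    bellMinNorm M ≤ 8 * quantumBound M := by
  have hB := quantumBound_nonneg M
  refine Real.sSup_le ?_ (by positivity)
  rintro _ ⟨H₁, _, _, _, H₂, _, _, _, u, v, hu, hv, rfl⟩
  rw [apply_map_bellTensor]
  refine (opNorm_le_of_norm_inner_le_add (C := 4 * quantumBound M) (by positivity)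
    fun x y => ?_).trans (by linarith)
  induction x, y using UniformSpace.Completion.induction_on₂ with
  | hp => exact isClosed_le (by fun_prop) (by fun_prop)
  | ih ξ η => exact norm_inner_bellOp_coe_le M hu hv ξ η

end LowerBound

section DualBall

variable {N K : ℕ}

theorem exists_dual_apply_basisVec {p : Fin N → Fin K → ℂ} (hp : ∀ x, ∑ a, ‖p x a‖ ≤ 1) :
    ∃ φ : L1Linf N K →L[ℂ] ℂ, ‖φ‖ ≤ 1 ∧ (fun x a => φ (basisVec x a)) = p := by
  let φ : L1Linf N K →ₗ[ℂ] ℂ := oneSumMap fun x => Fintype.linearCombination ℂ (p x)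
  have hφ (e : L1Linf N K) : ‖φ e‖ ≤ 1 * ‖e‖ := by
    rw [one_mul, PiLp.norm_eq_of_L1]
    simp only [φ, oneSumMap_apply, Fintype.linearCombination_apply, smul_eq_mul]
    refine norm_sum_le_of_le _ fun x _ => ?_
    calc ‖∑ a, e x a * p x a‖ ≤ ∑ a, ‖e x‖ * ‖p x a‖ :=
          norm_sum_le_of_le _ fun a _ => norm_mul_le_of_le (norm_le_pi_norm (e x) a) le_rfl
      _ = ‖e x‖ * ∑ a, ‖p x a‖ := by rw [Finset.mul_sum]
      _ ≤ ‖e x‖ := mul_le_of_le_one_right (norm_nonneg _) (hp x)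
  refine ⟨φ.mkContinuous 1 hφ, φ.mkContinuous_norm_le zero_le_one hφ, ?_⟩
  funext x a
  exact (oneSumMap_oneSumIncl _ x _).trans (by simp)

theorem sum_norm_apply_basisVec_le {φ : L1Linf N K →L[ℂ] ℂ} (hφ : ‖φ‖ ≤ 1) (x : Fin N) :
    ∑ a, ‖φ (basisVec x a)‖ ≤ 1 := by
  choose s hs hphase using fun a => RCLike.exists_norm_eq_mul_self (φ (basisVec x a))
  have hnorm : ‖oneSumIncl x s‖ ≤ 1 := by
    refine (PiLp.norm_single 1 (fun _ : Fin N => Fin K → ℂ) x s).trans_le ?_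
    exact (pi_norm_le_iff_of_nonneg zero_le_one).2 fun a => (hs a).le
  have hbasis : oneSumIncl x s = ∑ a, s a • basisVec x a :=
    map_eq_sum_smul_single (oneSumIncl x) s
  have hsum : ((∑ a, ‖φ (basisVec x a)‖ : ℝ) : ℂ) = φ (oneSumIncl x s) := by
    rw [hbasis, map_sum, Complex.ofReal_sum]
    exact Finset.sum_congr rfl fun a _ => by rw [map_smul, smul_eq_mul]; exact hphase a
  calc ∑ a, ‖φ (basisVec x a)‖ = ‖((∑ a, ‖φ (basisVec x a)‖ : ℝ) : ℂ)‖ :=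
        (Complex.norm_of_nonneg (by positivity)).symm
    _ = ‖φ (oneSumIncl x s)‖ := by rw [hsum]
    _ ≤ 1 := φ.le_of_opNorm_le_of_le hφ hnorm |>.trans_eq (one_mul 1)

end DualBall

section ClassicalBound

variable {N K : ℕ}

/-- The value `∑ M_{x,y}^{a,b} p(x,a) q(y,b)` of a product strategy, as a bilinear form. -/
def productValue (M : BellFunctional N K) :
    (Fin N → Fin K → ℂ) →ₗ[ℂ] (Fin N → Fin K → ℂ) →ₗ[ℂ] ℂ :=
  bellForm M (TensorProduct.lid ℂ ℂ).toLinearMap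

theorem lid_map_bellTensor (M : BellFunctional N K) (φ ψ : L1Linf N K →L[ℂ] ℂ) :
    TensorProduct.lid ℂ ℂ (TensorProduct.map φ.toLinearMap ψ.toLinearMap (bellTensor M)) =
      productValue M (fun x a => φ (basisVec x a)) (fun y b => ψ (basisVec y b)) :=
  apply_map_bellTensor M (TensorProduct.lid ℂ ℂ).toLinearMap φ.toLinearMap ψ.toLinearMap

theorem productValue_ofReal (M : BellFunctional N K) (p q : Fin N → Fin K → ℝ) :
    productValue M (fun x a => (p x a : ℂ)) (fun y b => (q y b : ℂ)) =
      pairing M fun x y a b => p x a * q y b := by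
  simp [productValue, bellForm_apply, pairing]

theorem norm_productValue_le_bellEpsNorm (M : BellFunctional N K) {p q : Fin N → Fin K → ℂ}
    (hp : ∀ x, ∑ a, ‖p x a‖ ≤ 1) (hq : ∀ y, ∑ b, ‖q y b‖ ≤ 1) :
    ‖productValue M p q‖ ≤ bellEpsNorm M := by
  have hle {p : Fin N → Fin K → ℂ} (hp : ∀ x, ∑ a, ‖p x a‖ ≤ 1) (x : Fin N) (a : Fin K) :
      ‖p x a‖ ≤ 1 :=
    (Finset.single_le_sum (f := fun a => ‖p x a‖) (fun _ _ => norm_nonneg _)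
      (Finset.mem_univ a)).trans (hp x)
  obtain ⟨φ, hφ, rfl⟩ := exists_dual_apply_basisVec hp
  obtain ⟨ψ, hψ, rfl⟩ := exists_dual_apply_basisVec hq
  refine le_csSup ⟨∑ x, ∑ y, ∑ a, ∑ b, ‖M x y a b‖, ?_⟩ ⟨φ, ψ, hφ, hψ, by rw [lid_map_bellTensor]⟩
  rintro _ ⟨φ', ψ', hφ', hψ', rfl⟩
  rw [lid_map_bellTensor]
  exact norm_bellForm_le M (fun v w => by simp) (hle (sum_norm_apply_basisVec_le hφ'))
    (hle (sum_norm_apply_basisVec_le hψ'))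

theorem bellEpsNorm_nonneg (M : BellFunctional N K) : 0 ≤ bellEpsNorm M := by
  refine Real.sSup_nonneg ?_
  rintro _ ⟨_, _, _, _, rfl⟩
  exact norm_nonneg _

theorem pairing_integral (M : BellFunctional N K) {Ω : Type*} [MeasurableSpace Ω]
    {μ : MeasureTheory.Measure Ω} {R : Ω → Behaviour N K}
    (hR : ∀ x y a b, MeasureTheory.Integrable (fun ω => R ω x y a b) μ) :
    pairing M (fun x y a b => ∫ ω, R ω x y a b ∂μ) = ∫ ω, pairing M (R ω) ∂μ := by
  have hflat (P : Behaviour N K) : pairing M P = ∑ i : Fin N × Fin N × Fin K × Fin K,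
      M i.1 i.2.1 i.2.2.1 i.2.2.2 * (P i.1 i.2.1 i.2.2.1 i.2.2.2 : ℂ) := by
    simp only [pairing, Fintype.sum_prod_type]
  simp only [hflat]
  rw [MeasureTheory.integral_finsetSum _ fun i _ => (hR _ _ _ _).ofReal.const_mul _]
  simp only [MeasureTheory.integral_const_mul, integral_complex_ofReal]

theorem integrable_mul_of_mem_unitInterval {Ω : Type*} [MeasurableSpace Ω]
    {μ : MeasureTheory.Measure Ω} [MeasureTheory.IsFiniteMeasure μ] {f g : Ω → ℝ}
    (hf : Measurable f) (hg : Measurable g) (hf' : ∀ ω, f ω ∈ unitInterval)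
    (hg' : ∀ ω, g ω ∈ unitInterval) : MeasureTheory.Integrable (fun ω => f ω * g ω) μ := by
  refine .of_bound (hf.mul hg).aestronglyMeasurable 1 (.of_forall fun ω => ?_)
  have hmem := unitInterval.mul_mem (hf' ω) (hg' ω)
  exact (Real.norm_of_nonneg hmem.1).trans_le hmem.2

theorem IsIncompleteClassical.norm_pairing_le_bellEpsNorm (M : BellFunctional N K)
    {P : Behaviour N K} (hP : IsIncompleteClassical P) : ‖pairing M P‖ ≤ bellEpsNorm M := by
  obtain ⟨Ω, _, μ, p, q, _, hpm, hqm, hp, hp', hq, hq', hP⟩ := hP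
  have hmem {p : Ω → Fin N → Fin K → ℝ} (hp : ∀ ω x a, 0 ≤ p ω x a)
      (hp' : ∀ ω x, ∑ a, p ω x a ≤ 1) (x a ω) : p ω x a ∈ unitInterval :=
    ⟨hp ω x a, (Finset.single_le_sum (fun a _ => hp ω x a) (Finset.mem_univ a)).trans (hp' ω x)⟩
  have hnorm {p : Ω → Fin N → Fin K → ℝ} (hp : ∀ ω x a, 0 ≤ p ω x a)
      (hp' : ∀ ω x, ∑ a, p ω x a ≤ 1) (ω x) : ∑ a, ‖(p ω x a : ℂ)‖ ≤ 1 := by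
    simpa only [Complex.norm_of_nonneg (hp ω x _)] using hp' ω x
  obtain rfl : P = fun x y a b => ∫ ω, p ω x a * q ω y b ∂μ := by
    funext x y a b
    exact hP x y a b
  rw [pairing_integral M fun x y a b => integrable_mul_of_mem_unitInterval (hpm x a) (hqm y b)
    (hmem hp hp' x a) (hmem hq hq' y b)]
  refine (MeasureTheory.norm_integral_le_of_norm_le_const (C := bellEpsNorm M)
    (.of_forall fun ω => ?_)).trans (by simp)
  rw [← productValue_ofReal]
  exact norm_productValue_le_bellEpsNorm M (hnorm hp hp' ω) (hnorm hq hq' ω)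

theorem classicalBound_le_bellEpsNorm (M : BellFunctional N K) :
    classicalBound M ≤ bellEpsNorm M := by
  refine Real.sSup_le ?_ (bellEpsNorm_nonneg M)
  rintro _ ⟨P, hP, rfl⟩
  exact hP.norm_pairing_le_bellEpsNorm M

theorem norm_pairing_mul_le_classicalBound (M : BellFunctional N K) {p q : Fin N → Fin K → ℝ}
    (hp : ∀ x a, 0 ≤ p x a) (hp' : ∀ x, ∑ a, p x a ≤ 1)
    (hq : ∀ y b, 0 ≤ q y b) (hq' : ∀ y, ∑ b, q y b ≤ 1) :
    ‖pairing M fun x y a b => p x a * q y b‖ ≤ classicalBound M := by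
  refine le_csSup ⟨bellEpsNorm M, ?_⟩ ⟨_, ?_, rfl⟩
  · rintro _ ⟨P, hP, rfl⟩
    exact hP.norm_pairing_le_bellEpsNorm M
  · exact ⟨Unit, inferInstance, MeasureTheory.Measure.dirac (), fun _ => p, fun _ => q,
      inferInstance, fun _ _ => measurable_const, fun _ _ => measurable_const, fun _ => hp,
      fun _ => hp', fun _ => hq, fun _ => hq', fun x y a b => by simp⟩

theorem classicalBound_nonneg (M : BellFunctional N K) : 0 ≤ classicalBound M := by
  refine Real.sSup_nonneg ?_
  rintro _ ⟨_, _, rfl⟩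
  exact norm_nonneg _

end ClassicalBound

section NonnegParts

/-- The four parts of `w = (Re w)⁺ + i (Im w)⁺ - (Re w)⁻ - i (Im w)⁻`, numbered by the power of
`i` in front of them. -/
def nonnegPart (w : ℂ) (k : Fin 4) : ℝ := max (star (Complex.I ^ (k : ℕ)) * w).re 0

theorem nonnegPart_le_norm (w : ℂ) (k : Fin 4) : nonnegPart w k ≤ ‖w‖ :=
  max_le ((Complex.re_le_norm _).trans_eq (by simp)) (norm_nonneg _)

theorem sum_I_pow_mul_nonnegPart (w : ℂ) :
    ∑ k : Fin 4, Complex.I ^ (k : ℕ) * (nonnegPart w k : ℂ) = w := by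
  simp only [Fin.sum_univ_four, nonnegPart, Fin.coe_ofNat_eq_mod, Nat.reduceMod, pow_zero,
    pow_one, Complex.I_sq, Complex.I_pow_three]
  apply Complex.ext
  · simpa [sub_eq_add_neg] using max_zero_sub_max_neg_zero_eq_self w.re
  · simpa [sub_eq_add_neg] using max_zero_sub_max_neg_zero_eq_self w.im

variable {N K : ℕ}

theorem norm_productValue_le_classicalBound (M : BellFunctional N K)
    {p q : Fin N → Fin K → ℂ} (hp : ∀ x, ∑ a, ‖p x a‖ ≤ 1) (hq : ∀ y, ∑ b, ‖q y b‖ ≤ 1) :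
    ‖productValue M p q‖ ≤ 16 * classicalBound M := by
  have hpart {p : Fin N → Fin K → ℂ} (hp : ∀ x, ∑ a, ‖p x a‖ ≤ 1) (k : Fin 4) (x : Fin N) :
      ∑ a, nonnegPart (p x a) k ≤ 1 :=
    (Finset.sum_le_sum fun a _ => nonnegPart_le_norm (p x a) k).trans (hp x)
  have hsum (p : Fin N → Fin K → ℂ) :
      p = ∑ k : Fin 4, Complex.I ^ (k : ℕ) • fun x a => (nonnegPart (p x a) k : ℂ) := by
    funext x a
    simp only [Finset.sum_apply, Pi.smul_apply, smul_eq_mul, sum_I_pow_mul_nonnegPart]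
  rw [hsum p, hsum q]
  refine (norm_map₂_sum_smul_le (r := classicalBound M) (productValue M) _ _
    fun k l => ?_).trans_eq (by norm_num)
  rw [productValue_ofReal]
  exact norm_pairing_mul_le_classicalBound M (fun _ _ => le_max_right _ _) (hpart hp k)
    (fun _ _ => le_max_right _ _) (hpart hq l)

theorem bellEpsNorm_le_sixteen_mul_classicalBound (M : BellFunctional N K) :
    bellEpsNorm M ≤ 16 * classicalBound M := by
  refine Real.sSup_le ?_ (mul_nonneg (by norm_num) (classicalBound_nonneg M))
  rintro _ ⟨φ, ψ, hφ, hψ, rfl⟩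
  rw [lid_map_bellTensor]
  exact norm_productValue_le_classicalBound M (sum_norm_apply_basisVec_le hφ)
    (sum_norm_apply_basisVec_le hψ)

end NonnegParts

end BellMin

end

theorem mainTheorem6 :
    (∀ (N K : ℕ) (M : BellMin.BellFunctional N K),
      BellMin.quantumBound M ≤ BellMin.bellMinNorm M ∧
      BellMin.bellMinNorm M ≤ 16 * BellMin.quantumBound M) ∧
    ∃ c C : ℝ, 0 < c ∧ 0 < C ∧
      ∀ (N K : ℕ) (M : BellMin.BellFunctional N K), BellMin.classicalBound M ≠ 0 →
        c * (BellMin.bellMinNorm M / BellMin.bellEpsNorm M) ≤ BellMin.largestViolation M ∧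
        BellMin.largestViolation M ≤ C * (BellMin.bellMinNorm M / BellMin.bellEpsNorm M) := by
  refine ⟨fun N K M => ⟨BellMin.quantumBound_le_bellMinNorm M, ?_⟩,
    1 / 8, 16, by norm_num, by norm_num, fun N K M hC => ?_⟩
  · linarith [BellMin.bellMinNorm_le_eight_mul_quantumBound M, BellMin.quantumBound_nonneg M]
  · have hCpos : 0 < BellMin.classicalBound M := (BellMin.classicalBound_nonneg M).lt_of_ne' hC
    have hCε := BellMin.classicalBound_le_bellEpsNorm M
    have hεC := BellMin.bellEpsNorm_le_sixteen_mul_classicalBound M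
    have hQmin := BellMin.quantumBound_le_bellMinNorm M
    have hminQ := BellMin.bellMinNorm_le_eight_mul_quantumBound M
    have hQ := BellMin.quantumBound_nonneg M
    have hεpos : 0 < BellMin.bellEpsNorm M := hCpos.trans_le hCε
    rw [BellMin.largestViolation]
    constructor
    · calc 1 / 8 * (BellMin.bellMinNorm M / BellMin.bellEpsNorm M)
          ≤ 1 / 8 * (8 * BellMin.quantumBound M / BellMin.classicalBound M) := by gcongr
        _ = BellMin.quantumBound M / BellMin.classicalBound M := by ring
    · calc BellMin.quantumBound M / BellMin.classicalBound M
          = 16 * (BellMin.quantumBound M / (16 * BellMin.classicalBound M)) := by field_simp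
        _ ≤ 16 * (BellMin.bellMinNorm M / BellMin.bellEpsNorm M) := by
            gcongr
            exact hQ.trans hQmin
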